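/- **Setting.** Let $E$ be a finite set of items and $O$ a set of states. A realization is a map $\phi:E\to O$; the random realization $\Phi$ has a known discrete prior $p(\phi)=\Pr[\Phi=\phi]$. A partial realization $\psi$ is a map from a subset $\mathrm{dom}(\psi)\subseteq E$ to $O$; $\psi\prec\phi$ means that $\phi$ extends $\psi$, and $\psi\subseteq\psi'$ that $\psi'$ extends $\psi$. Let $f:2^E\times O^E\to\mathbb R_{\ge 0}$ with $\mathbb E[f(S,\Phi)]<\infty$ for all $S\subseteq E$ (automatic if $O$ is finite). For $\Pr[\psi\prec\Phi]>0$ put $$\Delta(e\mid\psi)=\mathbb E\big[f(\mathrm{dom}(\psi)\cup\{e\},\Phi)-f(\mathrm{dom}(\psi),\Phi)\,\big|\,\psi\prec\Phi\big],\qquad f(e)=\mathbb E[f(\{e\},\Phi)].$$ The function $f$ is *adaptive submodular* with respect to $p$ if $\Delta(e\mid\psi)\ge\Delta(e\mid\psi')$ whenever $\psi\subseteq\psi'$, $\Pr[\psi'\prec\Phi]>0$ and $e\notin\mathrm{dom}(\psi')$. (Neither monotonicity nor submodularity of $f(\cdot,\phi)$ for fixed $\phi$ is assumed.) A (randomized)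 adaptive policy $\pi$ selects items one at a time and observes the state of each selected item; given the partial realization observed so far, it chooses, possibly at random and possibly using internal randomness independent of $\Phi$, the next item or stops. Let $E(\pi,\phi)$ be the random set of items that it selects under $\phi$, and $f_{avg}(\pi)=\mathbb E[f(E(\pi,\Phi),\Phi)]$, the expectation being over $\Phi$ and the randomness of $\pi$. Given costs $c_e>0$ and a budget $b$, the policy is *feasible* if for every $\phi$ with $p(\phi)>0$ one always has $\sum_{e\in E(\pi,\phi)}c_e\le b$. **The policy $\pi^{sad}$** with parameters $\delta_0,\delta_1,\delta_2$. Let $e^*\in\arg\max_{e\in E}f(e)$. Draw $S_1\subseteq E$ containing each item independently with probability $\delta_0$, and let $S_2=E\setminus S_1$. With probability $\delta_1$ select only $e^*$; with probability $\delta_2$ run density-greedy on $S_1$; with probability $1-\delta_1-\delta_2$ run density-greedy on $S_2$. Density-greedy on $S$: given the current observation $\psi$ and the remaining budget $C=b-\sum_{e\in\mathrm{dom}(\psi)}c_e$, let $$F=\{e\in S\setminus\mathrm{dom}(\psi): c_e\le C,\ \Delta(e\mid\psi)>0\};$$ stop if $F=\emptyset$, otherwise select an item of $\arg\max_{e\in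 F}\Delta(e\mid\psi)/c_e$ and observe its state. Ties are broken by an arbitrary linear order on $E$, which may depend on $\psi$ but not on $S$. **Theorem.** Let $E\ne\emptyset$ and let $f$ be adaptive submodular with respect to $p$. Take $\delta_0=1/2$, $\delta_1=1/5$, $\delta_2=2/5$. If $c_{e^*}\le b$ (in particular, if every item fits into the budget), then $\pi^{sad}$ is feasible. Moreover, for every feasible policy $\pi$, in particular for an optimal feasible policy $\pi=\pi^{opt}$, $$f_{avg}(\pi^{sad})\ \ge\ \tfrac1{10}\,f_{avg}(\pi).$$ -/

import Mathlib

open scoped NNReal ENNReal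

noncomputable section

namespace AdaptiveKnapsack

/-- A partial realization: `ψ e = some o` if the state `o` of `e` has been observed,
`ψ e = none` if `e` is not in the domain. -/
abbrev PartialRealization (E O : Type*) := E → Option O

section Realizations

variable {E O : Type*}

/-- The domain of a partial realization. -/
def dom [Fintype E] (ψ : PartialRealization E O) : Finset E :=
  Finset.univ.filter fun e => (ψ e).isSome = true

/-- `ψ ≺ φ`: the partial realization agrees with the realization on its domain. -/
def Consistent (ψ : PartialRealization E O) (φ : E → O) : Prop :=
  ∀ e o, ψ e = some o → φ e = o

/-- `ψ ⊆ ψ'`: `ψ` is a subrealization of `ψ'`. -/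
def Subrealization (ψ ψ' : PartialRealization E O) : Prop :=
  ∀ e o, ψ e = some o → ψ' e = some o

/-- `Pr[ψ ≺ Φ]`. -/
def probConsistent (p : PMF (E → O)) (ψ : PartialRealization E O) : ℝ≥0∞ :=
  p.toOuterMeasure {φ | Consistent ψ φ}

open Classical in
/-- The conditional probability `p(φ ∣ ψ) = Pr[Φ = φ ∣ ψ ≺ Φ]`
(meaningful when `Pr[ψ ≺ Φ] > 0`). -/
def posterior (p : PMF (E → O)) (ψ : PartialRealization E O) (φ : E → O) : ℝ :=
  if Consistent ψ φ then (p φ).toReal / (probConsistent p ψ).toReal else 0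

variable [Fintype E] [DecidableEq E]

/-- The conditional expected marginal utility `Δ(e ∣ ψ)`. -/
def marginal (p : PMF (E → O)) (f : Finset E → (E → O) → ℝ≥0) (e : E)
    (ψ : PartialRealization E O) : ℝ :=
  ∑' φ, posterior p ψ φ * ((f (insert e (dom ψ)) φ : ℝ) - (f (dom ψ) φ : ℝ))

/-- Adaptive submodularity of `f` with respect to `p`. As the conditional expectations must be
defined, only partial realizations of positive probability are compared
(if `ψ'` has positive probability, so does every `ψ ⊆ ψ'`). -/
def AdaptiveSubmodular (p : PMF (E → O)) (f : Finset E → (E → O) → ℝ≥0) : Prop :=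
  ∀ ψ ψ' : PartialRealization E O, Subrealization ψ ψ' → 0 < probConsistent p ψ' →
    ∀ e, e ∉ dom ψ' → marginal p f e ψ' ≤ marginal p f e ψ

/-- Expected utility of a fixed set, `𝔼[f(S, Φ)]`. -/
def expectedUtility (p : PMF (E → O)) (f : Finset E → (E → O) → ℝ≥0) (S : Finset E) : ℝ≥0∞ :=
  ∑' φ, p φ * (f S φ : ℝ≥0∞)

end Realizations

section Policies

variable {E O : Type*}

/-- A decision rule maps the current observation to a distribution over the next item to select;
`none` means that the selection stops. -/
abbrev Rule (E O : Type*) := PartialRealization E O → PMF (Option E)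

/-- An adaptive policy: an initial random draw (independent of the realization) of a decision rule,
which is then followed. A single rule `r` is the policy `PMF.pure r`. -/
abbrev Policy (E O : Type*) := PMF (Rule E O)

variable [Fintype E] [DecidableEq E]

/-- The law of the set of items selected by the rule `r` under the realization `φ`, starting from
the observation `ψ`, with at most `k` further selections. -/
def runFrom (r : Rule E O) (φ : E → O) : ℕ → PartialRealization E O → PMF (Finset E)
  | 0, ψ => PMF.pure (dom ψ)
  | k + 1, ψ => (r ψ).bind fun a =>
      match a with
      | none => PMF.pure (dom ψ)
      | some e => runFrom r φ k (Function.update ψ e (some (φ e)))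

/-- The law of `E(π, φ)`, the random set of items selected by `π` under the realization `φ`.
Since there are `Fintype.card E` items, that many selections always suffice. -/
def selected (π : Policy E O) (φ : E → O) : PMF (Finset E) :=
  π.bind fun r => runFrom r φ (Fintype.card E) (fun _ => none)

/-- The expected utility `f_avg(π)`, over both `Φ ∼ p` and the randomness of `π`. -/
def favg (p : PMF (E → O)) (f : Finset E → (E → O) → ℝ≥0) (π : Policy E O) : ℝ≥0∞ :=
  ∑' φ, p φ * ∑ S : Finset E, selected π φ S * (f S φ : ℝ≥0∞)

/-- Feasibility for the knapsack constraint with costs `c` and budget `b`: under every realization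
of positive probability, every possible set of selected items costs at most `b`. -/
def Feasible (p : PMF (E → O)) (c : E → ℝ) (b : ℝ) (π : Policy E O) : Prop :=
  ∀ φ, 0 < p φ → ∀ S, 0 < selected π φ S → ∑ e ∈ S, c e ≤ b

end Policies

section Sad

variable {E O : Type*} [Fintype E] [DecidableEq E]

/-- The rule that selects the single item `e` and stops. -/
def singletonRule (e : E) : Rule E O :=
  fun ψ => PMF.pure (if e ∈ dom ψ then none else some e)

open Classical in
/-- The candidates of the density-greedy rule on `S` after observing `ψ`: the items of `S` not yet
selected that fit into the remaining budget and have positive conditional expected marginal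
utility. -/
def candidates (p : PMF (E → O)) (f : Finset E → (E → O) → ℝ≥0) (c : E → ℝ) (b : ℝ)
    (S : Finset E) (ψ : PartialRealization E O) : Finset E :=
  (S \ dom ψ).filter fun e => c e ≤ b - ∑ e' ∈ dom ψ, c e' ∧ 0 < marginal p f e ψ

open Classical in
/-- The candidates with the largest benefit-to-cost ratio `Δ(e ∣ ψ) / c_e`. -/
def bestCandidates (p : PMF (E → O)) (f : Finset E → (E → O) → ℝ≥0) (c : E → ℝ) (b : ℝ)
    (S : Finset E) (ψ : PartialRealization E O) : Finset E :=
  (candidates p f c b S ψ).filter fun e =>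
    ∀ e' ∈ candidates p f c b S ψ, marginal p f e' ψ / c e' ≤ marginal p f e ψ / c e

/-- The density-greedy rule on `S`: as long as there is a candidate, select one with the largest
benefit-to-cost ratio. Ties after the observation `ψ` are broken by the linear order `tie ψ`. -/
def greedyRule (p : PMF (E → O)) (f : Finset E → (E → O) → ℝ≥0) (c : E → ℝ) (b : ℝ)
    (tie : PartialRealization E O → LinearOrder E) (S : Finset E) : Rule E O :=
  fun ψ => PMF.pure
    (if h : (bestCandidates p f c b S ψ).Nonempty then
      some (@Finset.min' E (tie ψ) (bestCandidates p f c b S ψ) h)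
    else none)

/-- The law of a random subset of `E` that contains each item independently with
probability `δ`. -/
def randomSubset (E : Type*) [Fintype E] [DecidableEq E] (δ : ℝ≥0) (hδ : δ ≤ 1) :
    PMF (Finset E) :=
  PMF.ofFintype (fun S => ((∏ _e ∈ S, δ) * ∏ _e ∈ Sᶜ, (1 - δ) : ℝ≥0)) (by
    have h := Finset.prod_add (fun _ : E => δ) (fun _ : E => 1 - δ) Finset.univ
    simp only [add_tsub_cancel_of_le hδ, Finset.prod_const_one, Finset.powerset_univ] at h
    rw [← ENNReal.ofNNReal_finsetSum]
    simp only [Finset.compl_eq_univ_sdiff]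
    exact_mod_cast h.symm)

/-- The law of the index of the candidate policy that is adopted: `0`, `1`, `2` with
probabilities `δ₁`, `δ₂`, `1 - δ₁ - δ₂`. -/
def policyIndex (δ₁ δ₂ : ℝ≥0) (h : δ₁ + δ₂ ≤ 1) : PMF (Fin 3) :=
  PMF.ofFintype (fun i => ((![δ₁, δ₂, 1 - (δ₁ + δ₂)] i : ℝ≥0) : ℝ≥0∞)) (by
    rw [← ENNReal.ofNNReal_finsetSum]
    have : ∑ i, ![δ₁, δ₂, 1 - (δ₁ + δ₂)] i = 1 := by
      simp [Fin.sum_univ_three, add_tsub_cancel_of_le h]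
    rw [this]; simp)

/-- The sampling-based adaptive density-greedy policy `π^sad`. It draws a random set `S₁`
(each item independently with probability `δ₀`), `S₂ = E \ S₁`, and adopts: with probability `δ₁`
the selection of the single item `estar`, with probability `δ₂` the density-greedy rule on `S₁`, and
with the remaining probability the density-greedy rule on `S₂`. -/
def sad (p : PMF (E → O)) (f : Finset E → (E → O) → ℝ≥0) (c : E → ℝ) (b : ℝ)
    (tie : PartialRealization E O → LinearOrder E) (estar : E)
    (δ₀ δ₁ δ₂ : ℝ≥0) (h₀ : δ₀ ≤ 1) (h₁₂ : δ₁ + δ₂ ≤ 1) : Policy E O :=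
  (policyIndex δ₁ δ₂ h₁₂).bind fun i =>
    (randomSubset E δ₀ h₀).map fun S₁ =>
      ![singletonRule estar, greedyRule p f c b tie S₁, greedyRule p f c b tie S₁ᶜ] i

end Sad

theorem half_le_one : (1 / 2 : ℝ≥0) ≤ 1 := by
  rw [← NNReal.coe_le_coe]; norm_num

theorem fifths_le_one : (1 / 5 : ℝ≥0) + 2 / 5 ≤ 1 := by
  rw [← NNReal.coe_le_coe]; norm_num

end AdaptiveKnapsack

end

/-!
A randomized feasible policy is no better than some deterministic decision tree with the same
budget: condition on each random choice and keep the best outcome.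

Let `t` be a feasible decision tree and let `M` be the largest expected utility of a single item.
Running density-greedy on `S` and then `t`, adaptive submodularity bounds what `t` adds by the
positive marginals, at the final greedy observation, of the items `o` it selects beyond the greedy
ones. Compare with the greedy run on `insert o S`: the two runs coincide until `o` is selected.
Either `o` is selected there, with a gain at least this marginal, or `o` stops fitting into the
budget after the run on `S` has selected only items at least as dense as `o`. In the second case the
marginal is at most `c o / b` times the greedy gain plus `M`, and these charges sum to at most the
greedy gain plus `M` because `t` respects the budget. Hence the union is worth at most twice the
greedy value, plus `M`, plus the gains of all `o` in the runs on `insert o S`. For random `S`,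
conditioning on `o ∈ S` shows that the last sum is on average at most `δ⁻¹` times the greedy value,
where `δ` is the probability of inclusion.

Neither union need be worth as much as `t`, since `f` is not assumed monotone. But greedy on `S` and
greedy on `Sᶜ` select disjoint sets, so by adaptive submodularity the two unions together are worth
at least as much as `t`.
-/

namespace AdaptiveKnapsack

open MeasureTheory ProbabilityTheory

section DiscreteProbability

variable {α β : Type*} [MeasurableSpace α] (p : PMF α)

theorem lintegral_toMeasure [MeasurableSingletonClass α] (X : α → ℝ≥0∞) :
    ∫⁻ a, X a ∂p.toMeasure = ∑' a, p a * X a := by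
  rw [← p.restrict_toMeasure_support, lintegral_countable X p.support_countable]
  simp only [p.toMeasure_apply_singleton _ (measurableSet_singleton _), mul_comm (X _)]
  refine tsum_subtype_eq_of_support_subset (f := fun a => p a * X a) fun a ha => ?_
  exact (p.mem_support_iff a).2 (left_ne_zero_of_mul ha)

theorem ae_toMeasure_apply_ne_zero [DiscreteMeasurableSpace α] :
    ∀ᵐ a ∂p.toMeasure, p a ≠ 0 := by
  refine (p.toMeasure_apply_eq_zero_iff (.of_discrete)).2 (Set.disjoint_left.2 fun a ha h => ?_)
  exact h ((p.mem_support_iff a).1 ha)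

theorem exists_mem_support_integral_le [DiscreteMeasurableSpace α] {X : α → ℝ}
    (hX : Integrable X p.toMeasure) : ∃ a ∈ p.support, ∫ a, X a ∂p.toMeasure ≤ X a := by
  obtain ⟨a, ha, hle⟩ := exists_notMem_null_integral_le hX (ae_toMeasure_apply_ne_zero p)
  exact ⟨a, (p.mem_support_iff a).2 (not_not.1 ha), hle⟩

variable [DiscreteMeasurableSpace α] {X Y : α → ℝ}

theorem hasSum_setIntegral_fiber (hX : Integrable X p.toMeasure) (s : Set α) (g : α → β) :
    HasSum (fun b : g '' p.support => ∫ a in s ∩ g ⁻¹' {(b : β)}, X a ∂p.toMeasure)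
      (∫ a in s, X a ∂p.toMeasure) := by
  have : Countable (g '' p.support) := (p.support_countable.image g).to_subtype
  have hcover : (s ∩ g ⁻¹' (g '' p.support) : Set α) =ᵐ[p.toMeasure] s := by
    filter_upwards [ae_toMeasure_apply_ne_zero p] with a ha
    exact propext (and_iff_left (Set.mem_image_of_mem g ((p.mem_support_iff a).2 ha)))
  have hunion : s ∩ g ⁻¹' (g '' p.support) =
      ⋃ b : g '' p.support, s ∩ g ⁻¹' {(b : β)} := by
    rw [← Set.inter_iUnion, ← Set.preimage_iUnion, Set.iUnion_of_singleton_coe]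
  rw [← setIntegral_congr_set hcover, hunion]
  refine hasSum_integral_iUnion (fun _ => .of_discrete) (fun b b' hb => ?_) hX.integrableOn
  refine Disjoint.mono Set.inter_subset_right Set.inter_subset_right (Disjoint.preimage g ?_)
  exact Set.disjoint_singleton.2 (Subtype.coe_injective.ne hb)

theorem integral_cond_le_of_fiber (hX : Integrable X p.toMeasure) (hY : Integrable Y p.toMeasure)
    (s : Set α) (g : α → β)
    (h : ∀ b, ∫ a, X a ∂p.toMeasure[|s ∩ g ⁻¹' {b}] ≤ ∫ a, Y a ∂p.toMeasure[|s ∩ g ⁻¹' {b}]) :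
    ∫ a, X a ∂p.toMeasure[|s] ≤ ∫ a, Y a ∂p.toMeasure[|s] := by
  simp only [ProbabilityTheory.cond, integral_smul_measure] at h ⊢
  refine smul_le_smul_of_nonneg_left ?_ ENNReal.toReal_nonneg
  refine hasSum_le (fun b => ?_) (hasSum_setIntegral_fiber p hX s g)
    (hasSum_setIntegral_fiber p hY s g)
  by_cases h0 : p.toMeasure (s ∩ g ⁻¹' {(b : β)}) = 0
  · simp only [Measure.restrict_eq_zero.2 h0, integral_zero_measure, le_refl]
  · refine le_of_smul_le_smul_left (h b) (ENNReal.toReal_pos ?_ ?_)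
    · exact ENNReal.inv_ne_zero.2 (measure_ne_top _ _)
    · exact ENNReal.inv_ne_top.2 h0

theorem integrable_sum_mem {ι : Type*} [Finite ι] {μ : Measure α}
    {w : ι → α → ℝ} (hw : ∀ i, Integrable (w i) μ) (B : α → Finset ι) :
    Integrable (fun a => ∑ i ∈ B a, w i a) μ := by
  classical
  have := Fintype.ofFinite ι
  have hsum : (fun a => ∑ i ∈ B a, w i a) =
      fun a => ∑ i, {a | i ∈ B a}.indicator (w i) a := by
    funext a
    simp only [Set.indicator_apply, Set.mem_ofPred_eq, Finset.sum_ite_mem, Finset.univ_inter]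
  rw [hsum]
  exact integrable_finsetSum _ fun i _ => (hw i).indicator .of_discrete

end DiscreteProbability

section Realizations

variable {E O : Type*}

theorem Subrealization.refl (ψ : PartialRealization E O) : Subrealization ψ ψ :=
  fun _ _ h => h

theorem Subrealization.trans {ψ₁ ψ₂ ψ₃ : PartialRealization E O}
    (h : Subrealization ψ₁ ψ₂) (h' : Subrealization ψ₂ ψ₃) : Subrealization ψ₁ ψ₃ :=
  fun e o he => h' e o (h e o he)

theorem subrealization_none (ψ : PartialRealization E O) : Subrealization (fun _ => none) ψ :=
  fun _ _ h => nomatch h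

theorem consistent_none (φ : E → O) : Consistent (fun _ => none) φ :=
  fun _ _ h => nomatch h

theorem Consistent.of_subrealization {ψ ψ' : PartialRealization E O} {φ : E → O}
    (h' : Consistent ψ' φ) (h : Subrealization ψ ψ') : Consistent ψ φ :=
  fun e o he => h' e o (h e o he)

theorem mem_dom [Fintype E] {ψ : PartialRealization E O} {e : E} :
    e ∈ dom ψ ↔ ∃ o, ψ e = some o := by
  simp [dom, Option.isSome_iff_exists]

@[simp]
theorem dom_none [Fintype E] : dom (fun _ => none : PartialRealization E O) = ∅ := by
  simp [dom]

variable [DecidableEq E]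

theorem Consistent.update {ψ : PartialRealization E O} {φ : E → O}
    (h : Consistent ψ φ) (e : E) : Consistent (Function.update ψ e (some (φ e))) φ := by
  intro e' o h'
  obtain rfl | he := eq_or_ne e' e
  · simpa using h'
  · exact h e' o (by simpa [he] using h')

theorem Consistent.apply_of_update {ψ : PartialRealization E O} {φ : E → O} {e : E} {o : O}
    (h : Consistent (Function.update ψ e (some o)) φ) : φ e = o :=
  h e o (Function.update_self ..)

theorem Consistent.subrealization_update {ψ : PartialRealization E O} {φ : E → O}
    (h : Consistent ψ φ) (e : E) : Subrealization ψ (Function.update ψ e (some (φ e))) := by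
  intro e' o h'
  obtain rfl | he := eq_or_ne e' e
  · simp [h _ _ h']
  · simpa [he] using h'

theorem Subrealization.consistent_update_iff {ψ : PartialRealization E O} {e : E} {o : O}
    (h : Subrealization ψ (Function.update ψ e (some o))) (φ : E → O) :
    Consistent (Function.update ψ e (some o)) φ ↔ Consistent ψ φ ∧ φ e = o :=
  ⟨fun h' => ⟨h'.of_subrealization h, h'.apply_of_update⟩,
    fun ⟨h', ho⟩ => ho ▸ h'.update e⟩

/-- The partial realization with domain `B` that is observed under the realization `φ`. -/
def observe (φ : E → O) (B : Finset E) : PartialRealization E O :=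
  fun e => if e ∈ B then some (φ e) else none

theorem consistent_observe (φ : E → O) (B : Finset E) : Consistent (observe φ B) φ := by
  intro e o h
  by_cases he : e ∈ B <;> simp_all [observe]

variable [Fintype E]

@[simp]
theorem dom_update (ψ : PartialRealization E O) (e : E) (o : O) :
    dom (Function.update ψ e (some o)) = insert e (dom ψ) := by
  ext e'
  obtain rfl | he := eq_or_ne e' e <;> simp_all [mem_dom]

@[simp]
theorem dom_observe (φ : E → O) (B : Finset E) : dom (observe φ B) = B := by
  ext e
  by_cases he : e ∈ B <;> simp [mem_dom, observe, he]

theorem Consistent.observe_dom {ψ : PartialRealization E O} {φ : E → O} (h : Consistent ψ φ) :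
    observe φ (dom ψ) = ψ := by
  funext e
  cases hψ : ψ e with
  | none => simp [observe, mem_dom, hψ]
  | some o => simp [observe, mem_dom, hψ, h e o hψ]

theorem Consistent.subrealization_observe {ψ : PartialRealization E O} {φ : E → O}
    (h : Consistent ψ φ) {B : Finset E} (hB : dom ψ ⊆ B) : Subrealization ψ (observe φ B) := by
  intro e o ho
  simp [observe, hB (mem_dom.2 ⟨o, ho⟩), h e o ho]

end Realizations

/-- The prior being discrete, every event is measurable. -/
local instance {E O : Type*} : MeasurableSpace (E → O) := ⊤

section Posterior

variable {E O : Type*}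

/-- The conditional law of `Φ` given `ψ ≺ Φ`, with point masses `posterior p ψ`. It is the zero
measure if `ψ ≺ Φ` has probability zero. -/
noncomputable def posteriorLaw (p : PMF (E → O)) (ψ : PartialRealization E O) :
    Measure (E → O) :=
  p.toMeasure[|{φ | Consistent ψ φ}]

instance (p : PMF (E → O)) (ψ : PartialRealization E O) :
    IsZeroOrProbabilityMeasure (posteriorLaw p ψ) :=
  inferInstanceAs (IsZeroOrProbabilityMeasure (p.toMeasure[|{φ | Consistent ψ φ}]))

variable {p : PMF (E → O)} {ψ : PartialRealization E O}

theorem posteriorLaw_none : posteriorLaw p (fun _ => none) = p.toMeasure := by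
  rw [posteriorLaw, Set.eq_univ_of_forall (s := {φ | Consistent _ φ}) consistent_none, cond_univ]

theorem probConsistent_eq_toMeasure :
    probConsistent p ψ = p.toMeasure {φ | Consistent ψ φ} :=
  (p.toMeasure_apply_eq_toOuterMeasure _).symm

theorem probConsistent_pos {φ : E → O} (h : Consistent ψ φ) (hφ : p φ ≠ 0) :
    0 < probConsistent p ψ := by
  rw [pos_iff_ne_zero, probConsistent, Ne, PMF.toOuterMeasure_apply_eq_zero_iff]
  exact fun hdisj => Set.disjoint_left.1 hdisj ((p.mem_support_iff φ).2 hφ) h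

theorem posteriorLaw_eq_zero (h : ¬ 0 < probConsistent p ψ) : posteriorLaw p ψ = 0 := by
  rw [probConsistent_eq_toMeasure, pos_iff_ne_zero, not_not] at h
  exact cond_eq_zero_of_meas_eq_zero h

theorem isProbabilityMeasure_posteriorLaw (h : 0 < probConsistent p ψ) :
    IsProbabilityMeasure (posteriorLaw p ψ) :=
  cond_isProbabilityMeasure (probConsistent_eq_toMeasure ▸ h.ne')

theorem ae_posteriorLaw : ∀ᵐ φ ∂posteriorLaw p ψ, p φ ≠ 0 ∧ Consistent ψ φ :=
  ((ae_toMeasure_apply_ne_zero p).filter_mono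
    (cond_absolutelyContinuous (s := {φ | Consistent ψ φ})).ae_le).and (ae_cond_mem .of_discrete)

theorem integrable_posteriorLaw {X : (E → O) → ℝ} (hX : Integrable X p.toMeasure)
    (ψ : PartialRealization E O) : Integrable X (posteriorLaw p ψ) := by
  by_cases h : 0 < probConsistent p ψ
  · exact hX.restrict.smul_measure (ENNReal.inv_ne_top.2 (probConsistent_eq_toMeasure ▸ h.ne'))
  · rw [posteriorLaw_eq_zero h]
    exact integrable_zero_measure

theorem integral_posteriorLaw_congr {X Y : (E → O) → ℝ}
    (h : ∀ φ, Consistent ψ φ → X φ = Y φ) :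
    ∫ φ, X φ ∂posteriorLaw p ψ = ∫ φ, Y φ ∂posteriorLaw p ψ :=
  integral_congr_ae (ae_posteriorLaw.mono fun φ hφ => h φ hφ.2)

theorem integral_posteriorLaw_mono {X Y : (E → O) → ℝ} (hX : Integrable X (posteriorLaw p ψ))
    (hY : Integrable Y (posteriorLaw p ψ)) (h : ∀ φ, p φ ≠ 0 → Consistent ψ φ → X φ ≤ Y φ) :
    ∫ φ, X φ ∂posteriorLaw p ψ ≤ ∫ φ, Y φ ∂posteriorLaw p ψ :=
  integral_mono_ae hX hY (ae_posteriorLaw.mono fun φ hφ => h φ hφ.1 hφ.2)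

theorem integral_posteriorLaw_eq_tsum {X : (E → O) → ℝ} (hX : Integrable X p.toMeasure) :
    ∫ φ, X φ ∂posteriorLaw p ψ = ∑' φ, posterior p ψ φ * X φ := by
  classical
  rw [posteriorLaw, ProbabilityTheory.cond, integral_smul_measure,
    ← integral_indicator .of_discrete, p.integral_eq_tsum _ (hX.indicator .of_discrete),
    smul_eq_mul, ← tsum_mul_left]
  refine tsum_congr fun φ => ?_
  by_cases hφ : Consistent ψ φ
  · rw [Set.indicator_of_mem hφ, posterior, if_pos hφ, probConsistent_eq_toMeasure, smul_eq_mul,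
      ENNReal.toReal_inv]
    ring
  · simp [posterior, hφ]

theorem integral_posteriorLaw_le_of_update [DecidableEq E] {X Y : (E → O) → ℝ}
    (hX : Integrable X p.toMeasure) (hY : Integrable Y p.toMeasure) (e : E)
    (h : ∀ o, Subrealization ψ (Function.update ψ e (some o)) →
      0 < probConsistent p (Function.update ψ e (some o)) →
      ∫ φ, X φ ∂posteriorLaw p (Function.update ψ e (some o)) ≤
        ∫ φ, Y φ ∂posteriorLaw p (Function.update ψ e (some o))) :
    ∫ φ, X φ ∂posteriorLaw p ψ ≤ ∫ φ, Y φ ∂posteriorLaw p ψ := by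
  refine integral_cond_le_of_fiber p hX hY _ (fun φ => φ e) fun o => ?_
  by_cases ho : Subrealization ψ (Function.update ψ e (some o))
  · have hfiber : {φ | Consistent ψ φ} ∩ (fun φ => φ e) ⁻¹' {o} =
        {φ | Consistent (Function.update ψ e (some o)) φ} :=
      Set.ext fun φ => (ho.consistent_update_iff φ).symm
    rw [hfiber]
    by_cases hpos : 0 < probConsistent p (Function.update ψ e (some o))
    · exact h o ho hpos
    · rw [← posteriorLaw, posteriorLaw_eq_zero hpos, integral_zero_measure, integral_zero_measure]
  · have hfiber : {φ | Consistent ψ φ} ∩ (fun φ => φ e) ⁻¹' {o} = ∅ :=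
      Set.eq_empty_of_forall_notMem fun φ ⟨hφ, hφo⟩ => ho (hφo ▸ hφ.subrealization_update e)
    simp only [hfiber, cond_empty, integral_zero_measure, le_refl]

end Posterior

section Utility

variable {E O : Type*} {p : PMF (E → O)} {f : Finset E → (E → O) → ℝ≥0}

theorem expectedUtility_eq_lintegral (S : Finset E) :
    expectedUtility p f S = ∫⁻ φ, f S φ ∂p.toMeasure :=
  (lintegral_toMeasure p _).symm

theorem toReal_expectedUtility (S : Finset E) :
    (expectedUtility p f S).toReal = ∫ φ, (f S φ : ℝ) ∂p.toMeasure := by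
  rw [expectedUtility_eq_lintegral,
    integral_eq_lintegral_of_nonneg_ae (.of_forall fun _ => NNReal.coe_nonneg _)
      Measurable.of_discrete.aestronglyMeasurable]
  simp only [ENNReal.ofReal_coe_nnreal]

theorem integrable_utility [Finite E] (hint : ∀ S, expectedUtility p f S ≠ ⊤)
    (B : (E → O) → Finset E) : Integrable (fun φ => (f (B φ) φ : ℝ)) p.toMeasure := by
  have := Fintype.ofFinite E
  have hfixed (S : Finset E) : Integrable (fun φ => (f S φ : ℝ)) p.toMeasure := by
    refine ⟨Measurable.of_discrete.aestronglyMeasurable, ?_⟩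
    simpa [HasFiniteIntegral, expectedUtility_eq_lintegral, lt_top_iff_ne_top] using hint S
  refine (integrable_finsetSum Finset.univ fun S _ => hfixed S).mono'
    Measurable.of_discrete.aestronglyMeasurable (.of_forall fun φ => ?_)
  rw [Real.norm_of_nonneg (NNReal.coe_nonneg _)]
  exact Finset.single_le_sum (f := fun S => (f S φ : ℝ)) (fun _ _ => NNReal.coe_nonneg _)
    (Finset.mem_univ (B φ))

variable [Fintype E] [DecidableEq E]

theorem marginal_of_mem {e : E} {ψ : PartialRealization E O} (h : e ∈ dom ψ) :
    marginal p f e ψ = 0 := by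
  simp [marginal, Finset.insert_eq_of_mem h]

theorem marginal_eq_integral (hint : ∀ S, expectedUtility p f S ≠ ⊤) (e : E)
    (ψ : PartialRealization E O) :
    marginal p f e ψ =
      ∫ φ, ((f (insert e (dom ψ)) φ : ℝ) - f (dom ψ) φ) ∂posteriorLaw p ψ :=
  (integral_posteriorLaw_eq_tsum
    ((integrable_utility hint _).sub (integrable_utility hint _))).symm

theorem integral_insert_utility (hint : ∀ S, expectedUtility p f S ≠ ⊤) (e : E)
    (ψ : PartialRealization E O) :
    ∫ φ, (f (insert e (dom ψ)) φ : ℝ) ∂posteriorLaw p ψ =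
      ∫ φ, (f (dom ψ) φ : ℝ) ∂posteriorLaw p ψ + marginal p f e ψ := by
  rw [marginal_eq_integral hint, integral_sub
    (integrable_posteriorLaw (integrable_utility hint _) ψ)
    (integrable_posteriorLaw (integrable_utility hint _) ψ)]
  ring

theorem integral_insert_utility_add (hint : ∀ S, expectedUtility p f S ≠ ⊤) (e : E)
    (ψ : PartialRealization E O) {R : (E → O) → ℝ} (hR : Integrable R p.toMeasure) :
    ∫ φ, ((f (insert e (dom ψ)) φ : ℝ) + R φ) ∂posteriorLaw p ψ =
      ∫ φ, ((f (dom ψ) φ : ℝ) + (marginal p f e ψ + R φ)) ∂posteriorLaw p ψ := by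
  by_cases hψ : 0 < probConsistent p ψ
  · have := isProbabilityMeasure_posteriorLaw hψ
    have hI (B) := integrable_posteriorLaw (integrable_utility (p := p) hint B) ψ
    have hR' := integrable_posteriorLaw hR ψ
    have hsum : Integrable (fun φ => marginal p f e ψ + R φ) (posteriorLaw p ψ) :=
      (integrable_const _).add hR'
    rw [integral_add (hI _) hR', integral_add (hI _) hsum, integral_add (integrable_const _) hR',
      integral_const, probReal_univ, one_smul, integral_insert_utility hint, add_assoc]
  · rw [posteriorLaw_eq_zero hψ, integral_zero_measure, integral_zero_measure]

theorem AdaptiveSubmodular.marginal_le (hf : AdaptiveSubmodular p f)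
    (hint : ∀ S, expectedUtility p f S ≠ ⊤) (e : E) (ψ : PartialRealization E O) :
    marginal p f e ψ ≤ (expectedUtility p f {e}).toReal := by
  by_cases hψ : 0 < probConsistent p ψ
  · by_cases he : e ∈ dom ψ
    · exact (marginal_of_mem he).trans_le ENNReal.toReal_nonneg
    · refine (hf _ ψ (subrealization_none ψ) hψ e he).trans ?_
      have hempty := integral_insert_utility (p := p) hint e fun _ => none
      have hnonneg : 0 ≤ ∫ φ, (f ∅ φ : ℝ) ∂p.toMeasure :=
        integral_nonneg fun _ => NNReal.coe_nonneg _
      rw [dom_none, posteriorLaw_none, insert_empty_eq, ← toReal_expectedUtility] at hempty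
      linarith
  · rw [marginal_eq_integral hint, posteriorLaw_eq_zero hψ, integral_zero_measure]
    exact ENNReal.toReal_nonneg

theorem AdaptiveSubmodular.integrable_max_marginal (hf : AdaptiveSubmodular p f)
    (hint : ∀ S, expectedUtility p f S ≠ ⊤) (B : (E → O) → Finset E) (e : E) :
    Integrable (fun φ => max (marginal p f e (observe φ (B φ))) 0) p.toMeasure := by
  refine .of_bound Measurable.of_discrete.aestronglyMeasurable
    (expectedUtility p f {e}).toReal (.of_forall fun φ => ?_)
  rw [Real.norm_of_nonneg (le_max_right _ _)]
  exact max_le (hf.marginal_le hint e _) ENNReal.toReal_nonneg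

end Utility

/-- A deterministic adaptive policy, as a decision tree: a `query` selects an item and continues
according to its state. -/
inductive DecisionTree (E O : Type*)
  | leaf : DecisionTree E O
  | query (e : E) (next : O → DecisionTree E O) : DecisionTree E O

namespace DecisionTree

section Tree

variable {E O : Type*}

/-- The items selected by a decision tree under the realization `φ`. -/
def items [DecidableEq E] : DecisionTree E O → (E → O) → Finset E
  | leaf, _ => ∅
  | query e next, φ => insert e (items (next (φ e)) φ)

/-- All items that occur in the tree belong to `S`. -/
def QueriesIn (S : Finset E) : DecisionTree E O → Prop
  | leaf => True
  | query e next => e ∈ S ∧ ∀ o, QueriesIn S (next o)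

theorem queriesIn_univ [Fintype E] (t : DecisionTree E O) : t.QueriesIn Finset.univ := by
  induction t with
  | leaf => trivial
  | query e next ih => exact ⟨Finset.mem_univ e, ih⟩

/-- The expected utility of the set of items selected by a decision tree. -/
noncomputable def value [DecidableEq E] (p : PMF (E → O)) (f : Finset E → (E → O) → ℝ≥0)
    (t : DecisionTree E O) : ℝ :=
  ∫ φ, (f (t.items φ) φ : ℝ) ∂p.toMeasure

theorem value_nonneg [DecidableEq E] {p : PMF (E → O)} {f : Finset E → (E → O) → ℝ≥0}
    (t : DecisionTree E O) : 0 ≤ t.value p f :=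
  integral_nonneg fun _ => NNReal.coe_nonneg _

variable [Fintype E] [DecidableEq E]

theorem dom_union_items_query {ψ : PartialRealization E O} {φ : E → O} {e : E} {o : O}
    (next : O → DecisionTree E O) (h : Consistent (Function.update ψ e (some o)) φ) :
    dom ψ ∪ (query e next).items φ =
      dom (Function.update ψ e (some o)) ∪ (next o).items φ := by
  rw [dom_update, items, h.apply_of_update, Finset.union_insert, Finset.insert_union]

variable {p : PMF (E → O)} {f : Finset E → (E → O) → ℝ≥0}

theorem integral_le_of_leaves {S : Finset E} {X Y : Finset E → (E → O) → ℝ}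
    (hX : ∀ B : (E → O) → Finset E, Integrable (fun φ => X (B φ) φ) p.toMeasure)
    (hY : ∀ B : (E → O) → Finset E, Integrable (fun φ => Y (B φ) φ) p.toMeasure)
    {t : DecisionTree E O} (ht : t.QueriesIn S) (ψ : PartialRealization E O)
    (h : ∀ ψ', Subrealization ψ ψ' → 0 < probConsistent p ψ' → dom ψ' ⊆ dom ψ ∪ S →
      ∫ φ, X (dom ψ') φ ∂posteriorLaw p ψ' ≤ ∫ φ, Y (dom ψ') φ ∂posteriorLaw p ψ') :
    ∫ φ, X (dom ψ ∪ t.items φ) φ ∂posteriorLaw p ψ ≤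
      ∫ φ, Y (dom ψ ∪ t.items φ) φ ∂posteriorLaw p ψ := by
  induction t generalizing ψ with
  | leaf =>
    simp only [items, Finset.union_empty]
    by_cases hψ : 0 < probConsistent p ψ
    · exact h ψ (.refl ψ) hψ Finset.subset_union_left
    · rw [posteriorLaw_eq_zero hψ, integral_zero_measure, integral_zero_measure]
  | query e next ih =>
    refine integral_posteriorLaw_le_of_update (hX _) (hY _) e fun o ho _ => ?_
    have hnext (Z : Finset E → (E → O) → ℝ) :
        ∫ φ, Z (dom ψ ∪ (query e next).items φ) φ
            ∂posteriorLaw p (Function.update ψ e (some o)) =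
          ∫ φ, Z (dom (Function.update ψ e (some o)) ∪ (next o).items φ) φ
            ∂posteriorLaw p (Function.update ψ e (some o)) :=
      integral_posteriorLaw_congr fun φ hφ => by rw [dom_union_items_query next hφ]
    rw [hnext X, hnext Y]
    refine ih o (ht.2 o) _ fun ψ' hψ' hpos hdom => h ψ' (ho.trans hψ') hpos (hdom.trans ?_)
    rw [dom_update, Finset.insert_union]
    exact Finset.insert_subset (Finset.mem_union_right _ ht.1) subset_rfl

theorem integral_insert_items_le (hint : ∀ S, expectedUtility p f S ≠ ⊤)
    (hf : AdaptiveSubmodular p f) {S : Finset E} {t : DecisionTree E O} (ht : t.QueriesIn S)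
    {e : E} (he : e ∉ S) (ψ : PartialRealization E O) :
    ∫ φ, (f (insert e (dom ψ ∪ t.items φ)) φ : ℝ) ∂posteriorLaw p ψ ≤
      ∫ φ, (f (dom ψ ∪ t.items φ) φ : ℝ) ∂posteriorLaw p ψ + marginal p f e ψ := by
  by_cases hψ : 0 < probConsistent p ψ
  swap
  · simp [posteriorLaw_eq_zero hψ, marginal_eq_integral hint]
  have hadd {ψ' : PartialRealization E O} (hpos : 0 < probConsistent p ψ')
      (B : (E → O) → Finset E) :
      ∫ φ, ((f (B φ) φ : ℝ) + marginal p f e ψ) ∂posteriorLaw p ψ' =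
        ∫ φ, (f (B φ) φ : ℝ) ∂posteriorLaw p ψ' + marginal p f e ψ := by
    have := isProbabilityMeasure_posteriorLaw hpos
    rw [integral_add (integrable_posteriorLaw (integrable_utility hint B) ψ')
      (integrable_const _), integral_const, probReal_univ, one_smul]
  rw [← hadd hψ]
  refine integral_le_of_leaves (X := fun B φ => (f (insert e B) φ : ℝ))
    (Y := fun B φ => (f B φ : ℝ) + marginal p f e ψ) (fun B => integrable_utility hint _)
    (fun B => (integrable_utility hint B).add (integrable_const _)) ht ψ
    fun ψ' hψ' hpos hdom => ?_
  rw [integral_insert_utility hint, hadd hpos]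
  refine add_le_add_right ?_ _
  by_cases he' : e ∈ dom ψ'
  · have heψ : e ∈ dom ψ := (Finset.mem_union.1 (hdom he')).resolve_right he
    rw [marginal_of_mem he', marginal_of_mem heψ]
  · exact hf ψ ψ' hψ' hpos e he'

theorem integral_union_add_le (hint : ∀ S, expectedUtility p f S ≠ ⊤)
    (hf : AdaptiveSubmodular p f) {S S' : Finset E} (hS : Disjoint S S') {g g' : DecisionTree E O}
    (hg : g.QueriesIn S) (hg' : g'.QueriesIn S') (ψ : PartialRealization E O) :
    ∫ φ, (f (dom ψ ∪ g.items φ ∪ g'.items φ) φ : ℝ) ∂posteriorLaw p ψ +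
        ∫ φ, (f (dom ψ) φ : ℝ) ∂posteriorLaw p ψ ≤
      ∫ φ, (f (dom ψ ∪ g.items φ) φ : ℝ) ∂posteriorLaw p ψ +
        ∫ φ, (f (dom ψ ∪ g'.items φ) φ : ℝ) ∂posteriorLaw p ψ := by
  have hI (B) := integrable_utility (p := p) hint B
  have hIψ (ψ) (B) := integrable_posteriorLaw (hI B) ψ
  induction g generalizing ψ with
  | leaf => simp only [items, Finset.union_empty, add_comm, le_refl]
  | query e next ih =>
    have hafter : ∫ φ, (f (dom ψ ∪ (query e next).items φ ∪ g'.items φ) φ : ℝ)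
          ∂posteriorLaw p ψ + ∫ φ, (f (insert e (dom ψ)) φ : ℝ) ∂posteriorLaw p ψ ≤
        ∫ φ, (f (dom ψ ∪ (query e next).items φ) φ : ℝ) ∂posteriorLaw p ψ +
          ∫ φ, (f (insert e (dom ψ ∪ g'.items φ)) φ : ℝ) ∂posteriorLaw p ψ := by
      rw [← integral_add (hIψ _ _) (hIψ _ _), ← integral_add (hIψ _ _) (hIψ _ _)]
      refine integral_posteriorLaw_le_of_update ((hI _).add (hI _)) ((hI _).add (hI _)) e
        fun o _ _ => ?_
      have hnext := ih o (hg.2 o) (Function.update ψ e (some o))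
      rw [← integral_add (hIψ _ _) (hIψ _ _), ← integral_add (hIψ _ _) (hIψ _ _)] at hnext
      convert hnext using 1 <;>
        exact integral_posteriorLaw_congr fun φ hφ => by
          simp only [dom_union_items_query next hφ, dom_update, Finset.insert_union]
    have hbefore := integral_insert_items_le hint hf hg' (Finset.disjoint_left.1 hS hg.1) ψ
    have hinsert := integral_insert_utility (p := p) hint e ψ
    linarith

theorem integral_items_le_add (hint : ∀ S, expectedUtility p f S ≠ ⊤)
    (hf : AdaptiveSubmodular p f) {S S' : Finset E} (hS : Disjoint S S') {g g' : DecisionTree E O}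
    (hg : g.QueriesIn S) (hg' : g'.QueriesIn S') (t : DecisionTree E O)
    (ψ : PartialRealization E O) :
    ∫ φ, (f (dom ψ ∪ t.items φ) φ : ℝ) ∂posteriorLaw p ψ ≤
      ∫ φ, ((f (dom ψ ∪ t.items φ ∪ g.items φ) φ : ℝ) + f (dom ψ ∪ t.items φ ∪ g'.items φ) φ)
        ∂posteriorLaw p ψ := by
  have hI (B) := integrable_utility (p := p) hint B
  refine integral_le_of_leaves (X := fun B φ => (f B φ : ℝ))
    (Y := fun B φ => (f (B ∪ g.items φ) φ : ℝ) + f (B ∪ g'.items φ) φ)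
    hI (fun B => (hI _).add (hI _)) t.queriesIn_univ ψ fun ψ' _ _ _ => ?_
  rw [integral_add (integrable_posteriorLaw (hI _) ψ') (integrable_posteriorLaw (hI _) ψ')]
  have hunion : 0 ≤ ∫ φ, (f (dom ψ' ∪ g.items φ ∪ g'.items φ) φ : ℝ) ∂posteriorLaw p ψ' :=
    integral_nonneg fun _ => NNReal.coe_nonneg _
  have := integral_union_add_le hint hf hS hg hg' ψ'
  linarith

theorem integral_items_le_add_sum (hint : ∀ S, expectedUtility p f S ≠ ⊤) (t : DecisionTree E O)
    {ψ : PartialRealization E O} {w : E → ℝ}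
    (hw : ∀ ψ', Subrealization ψ ψ' → 0 < probConsistent p ψ' → ∀ e, e ∉ dom ψ' →
      marginal p f e ψ' ≤ w e) :
    ∫ φ, (f (dom ψ ∪ t.items φ) φ : ℝ) ∂posteriorLaw p ψ ≤
      ∫ φ, ((f (dom ψ) φ : ℝ) + ∑ e ∈ t.items φ \ dom ψ, w e) ∂posteriorLaw p ψ := by
  have hI (B) := integrable_utility (p := p) hint B
  have hW (B : (E → O) → Finset E) : Integrable (fun φ => ∑ e ∈ B φ, w e) p.toMeasure :=
    integrable_sum_mem (fun e => integrable_const (w e)) B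
  induction t generalizing ψ with
  | leaf =>
    simp only [items, Finset.union_empty, Finset.empty_sdiff, Finset.sum_empty, add_zero, le_refl]
  | query e next ih =>
    have hafter : ∫ φ, (f (dom ψ ∪ (query e next).items φ) φ : ℝ) ∂posteriorLaw p ψ ≤
        ∫ φ, ((f (insert e (dom ψ)) φ : ℝ) +
          ∑ e' ∈ (query e next).items φ \ insert e (dom ψ), w e') ∂posteriorLaw p ψ := by
      refine integral_posteriorLaw_le_of_update (hI _) ((hI _).add (hW _)) e fun o ho _ => ?_
      convert ih o fun ψ' hψ' => hw ψ' (ho.trans hψ') using 1 <;>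
        refine integral_posteriorLaw_congr fun φ hφ => ?_
      · rw [dom_union_items_query next hφ]
      · rw [dom_update, items, hφ.apply_of_update,
          Finset.insert_sdiff_of_mem _ (Finset.mem_insert_self _ _)]
    by_cases he : e ∈ dom ψ
    · simpa only [Finset.insert_eq_of_mem he] using hafter
    have hsplit (φ : E → O) : ∑ e' ∈ (query e next).items φ \ dom ψ, w e' =
        w e + ∑ e' ∈ (query e next).items φ \ insert e (dom ψ), w e' := by
      have hmem : e ∈ (query e next).items φ \ dom ψ :=
        Finset.mem_sdiff.2 ⟨Finset.mem_insert_self _ _, he⟩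
      rw [← Finset.add_sum_erase _ _ hmem, Finset.sdiff_insert]
    rw [integral_insert_utility_add hint e ψ (hW _)] at hafter
    refine hafter.trans (integral_posteriorLaw_mono
      (integrable_posteriorLaw ((hI _).add ((integrable_const _).add (hW _))) ψ)
      (integrable_posteriorLaw ((hI _).add (hW _)) ψ) fun φ hφ hcons => ?_)
    rw [hsplit]
    gcongr
    exact hw ψ (.refl ψ) (probConsistent_pos hcons hφ) e he

theorem integral_union_le_add_sum (hint : ∀ S, expectedUtility p f S ≠ ⊤)
    (hf : AdaptiveSubmodular p f) (g t : DecisionTree E O) (ψ : PartialRealization E O) :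
    ∫ φ, (f (dom ψ ∪ g.items φ ∪ t.items φ) φ : ℝ) ∂posteriorLaw p ψ ≤
      ∫ φ, ((f (dom ψ ∪ g.items φ) φ : ℝ) + ∑ e ∈ t.items φ \ (dom ψ ∪ g.items φ),
          max (marginal p f e (observe φ (dom ψ ∪ g.items φ))) 0) ∂posteriorLaw p ψ := by
  have hI (B) := integrable_utility (p := p) hint B
  refine integral_le_of_leaves (X := fun B φ => (f (B ∪ t.items φ) φ : ℝ))
    (Y := fun B φ => (f B φ : ℝ) + ∑ e ∈ t.items φ \ B, max (marginal p f e (observe φ B)) 0)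
    (fun B => hI _) (fun B => (hI _).add (integrable_sum_mem (hf.integrable_max_marginal hint B) _))
    g.queriesIn_univ ψ fun ψ' _ _ _ => ?_
  refine (integral_items_le_add_sum hint t (w := fun e => max (marginal p f e ψ') 0)
    fun ψ'' hψ'' hpos e he => (hf ψ' ψ'' hψ'' hpos e he).trans (le_max_left _ _)).trans_eq ?_
  exact integral_posteriorLaw_congr fun φ hφ => by rw [hφ.observe_dom]

/-- The conditional expected marginal utility of the item `o` at the moment when it is selected by
the tree, started at the observation `ψ`, under the realization `φ`; it is `0` if `o` is never
selected. -/
noncomputable def itemGain (p : PMF (E → O)) (f : Finset E → (E → O) → ℝ≥0) :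
    DecisionTree E O → PartialRealization E O → (E → O) → E → ℝ
  | leaf, _, _, _ => 0
  | query e next, ψ, φ, o => (if o = e then marginal p f e ψ else 0) +
      itemGain p f (next (φ e)) (Function.update ψ e (some (φ e))) φ o

theorem sum_itemGain_query (e : E) (next : O → DecisionTree E O) (ψ : PartialRealization E O)
    (φ : E → O) :
    ∑ o, itemGain p f (query e next) ψ φ o = marginal p f e ψ +
      ∑ o, itemGain p f (next (φ e)) (Function.update ψ e (some (φ e))) φ o := by
  simp only [itemGain, Finset.sum_add_distrib, Finset.sum_ite_eq', Finset.mem_univ, if_true]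

end Tree

section Choice

variable {E O : Type*} [DecidableEq E] (choice : PartialRealization E O → Option E)

/-- The decision tree that follows the deterministic rule `choice`, started at the observation `ψ`
and truncated after `k` selections. -/
def ofChoice : ℕ → PartialRealization E O → DecisionTree E O
  | 0, _ => leaf
  | k + 1, ψ => match choice ψ with
    | none => leaf
    | some e => query e fun o => ofChoice k (Function.update ψ e (some o))

variable {choice} {ψ : PartialRealization E O} {k : ℕ}

theorem ofChoice_of_eq_none (h : choice ψ = none) : ofChoice choice k ψ = leaf := by
  cases k <;> simp only [ofChoice, h]

theorem ofChoice_succ_of_eq_some {e : E} (h : choice ψ = some e) :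
    ofChoice choice (k + 1) ψ =
      query e fun o => ofChoice choice k (Function.update ψ e (some o)) := by
  simp only [ofChoice, h]

theorem queriesIn_ofChoice {S : Finset E} (h : ∀ ψ e, choice ψ = some e → e ∈ S) (k : ℕ)
    (ψ : PartialRealization E O) : (ofChoice choice k ψ).QueriesIn S := by
  induction k generalizing ψ with
  | zero => trivial
  | succ k ih =>
    cases he : choice ψ with
    | none => rw [ofChoice_of_eq_none he]; trivial
    | some e => rw [ofChoice_succ_of_eq_some he]; exact ⟨h ψ e he, fun o => ih _⟩

variable [Fintype E] {p : PMF (E → O)} {f : Finset E → (E → O) → ℝ≥0}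

theorem dom_union_items_ofChoice_succ {e : E} (h : choice ψ = some e) (φ : E → O) :
    dom ψ ∪ (ofChoice choice (k + 1) ψ).items φ =
      dom (Function.update ψ e (some (φ e))) ∪
        (ofChoice choice k (Function.update ψ e (some (φ e)))).items φ := by
  rw [ofChoice_succ_of_eq_some h, items, dom_update, Finset.union_insert, Finset.insert_union]

theorem runFrom_pure_choice (φ : E → O) (k : ℕ) (ψ : PartialRealization E O) :
    runFrom (fun ψ => PMF.pure (choice ψ)) φ k ψ =
      PMF.pure (dom ψ ∪ (ofChoice choice k ψ).items φ) := by
  induction k generalizing ψ with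
  | zero => simp only [runFrom, ofChoice, items, Finset.union_empty]
  | succ k ih =>
    rw [runFrom, PMF.pure_bind]
    cases h : choice ψ with
    | none => simp only [ofChoice_of_eq_none h, items, Finset.union_empty]
    | some e => rw [dom_union_items_ofChoice_succ h]; exact ih _

theorem sum_items_ofChoice_le {c : E → ℝ} {b : ℝ}
    (h : ∀ ψ e, choice ψ = some e → ∑ e' ∈ insert e (dom ψ), c e' ≤ b)
    (hψ : ∑ e ∈ dom ψ, c e ≤ b) (φ : E → O) :
    ∑ e ∈ dom ψ ∪ (ofChoice choice k ψ).items φ, c e ≤ b := by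
  induction k generalizing ψ with
  | zero => simpa only [ofChoice, items, Finset.union_empty] using hψ
  | succ k ih =>
    cases he : choice ψ with
    | none => simpa only [ofChoice_of_eq_none he, items, Finset.union_empty] using hψ
    | some e => rw [dom_union_items_ofChoice_succ he]; exact ih (by simpa using h ψ e he)

theorem sum_itemGain_ofChoice_le {M : ℝ} (hM : ∀ e ψ, marginal p f e ψ ≤ M) (k : ℕ)
    (ψ : PartialRealization E O) (φ : E → O) :
    ∑ o, itemGain p f (ofChoice choice k ψ) ψ φ o ≤ k * max M 0 := by
  induction k generalizing ψ with
  | zero => simp [ofChoice, itemGain]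
  | succ k ih =>
    cases h : choice ψ with
    | none =>
      simp only [ofChoice_of_eq_none h, itemGain, Finset.sum_const_zero]
      positivity
    | some e =>
      rw [ofChoice_succ_of_eq_some h, sum_itemGain_query]
      push_cast
      linarith [ih (Function.update ψ e (some (φ e))), hM e ψ, le_max_left M 0]

theorem itemGain_ofChoice_nonneg (hchoice : ∀ ψ e, choice ψ = some e → 0 ≤ marginal p f e ψ)
    (k : ℕ) (ψ : PartialRealization E O) (φ : E → O) (o : E) :
    0 ≤ itemGain p f (ofChoice choice k ψ) ψ φ o := by
  induction k generalizing ψ with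
  | zero => exact le_rfl
  | succ k ih =>
    cases h : choice ψ with
    | none => rw [ofChoice_of_eq_none h]; exact le_rfl
    | some e =>
      rw [ofChoice_succ_of_eq_some h, itemGain]
      exact add_nonneg (ite_nonneg (hchoice ψ e h) le_rfl) (ih _)

theorem integrable_itemGain_ofChoice
    (hchoice : ∀ ψ e, choice ψ = some e → 0 ≤ marginal p f e ψ) {M : ℝ}
    (hM : ∀ e ψ, marginal p f e ψ ≤ M) (k : ℕ) (ψ : PartialRealization E O) (o : E) :
    Integrable (fun φ => itemGain p f (ofChoice choice k ψ) ψ φ o) p.toMeasure := by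
  refine .of_bound Measurable.of_discrete.aestronglyMeasurable (k * max M 0)
    (.of_forall fun φ => ?_)
  rw [Real.norm_of_nonneg (itemGain_ofChoice_nonneg hchoice k ψ φ o)]
  refine le_trans ?_ (sum_itemGain_ofChoice_le (choice := choice) hM k ψ φ)
  exact Finset.single_le_sum (fun o _ => itemGain_ofChoice_nonneg hchoice k ψ φ o)
    (Finset.mem_univ o)

theorem integral_add_sum_itemGain_le
    (hchoice : ∀ ψ e, choice ψ = some e → 0 ≤ marginal p f e ψ)
    (hint : ∀ S, expectedUtility p f S ≠ ⊤) {M : ℝ}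
    (hM : ∀ e ψ, marginal p f e ψ ≤ M) (k : ℕ) (ψ : PartialRealization E O) :
    ∫ φ, ((f (dom ψ) φ : ℝ) + ∑ o, itemGain p f (ofChoice choice k ψ) ψ φ o)
        ∂posteriorLaw p ψ ≤
      ∫ φ, (f (dom ψ ∪ (ofChoice choice k ψ).items φ) φ : ℝ) ∂posteriorLaw p ψ := by
  induction k generalizing ψ with
  | zero => simp [ofChoice, itemGain, items]
  | succ k ih =>
    cases h : choice ψ with
    | none => simp [ofChoice_of_eq_none h, itemGain, items]
    | some e =>
      have hrest : Integrable (fun φ => ∑ o, itemGain p f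
          (ofChoice choice k (Function.update ψ e (some (φ e))))
          (Function.update ψ e (some (φ e))) φ o) p.toMeasure := by
        have := (integrable_finsetSum Finset.univ fun o _ =>
          integrable_itemGain_ofChoice hchoice hM (k + 1) ψ o).sub
            (integrable_const (marginal p f e ψ))
        refine this.congr (.of_forall fun φ => ?_)
        simp only [ofChoice_succ_of_eq_some h, Pi.sub_apply, sum_itemGain_query,
          add_sub_cancel_left]
      simp only [ofChoice_succ_of_eq_some h, sum_itemGain_query]
      rw [← integral_insert_utility_add hint e ψ hrest]
      refine integral_posteriorLaw_le_of_update ((integrable_utility hint _).add hrest)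
        (integrable_utility hint _) e fun o _ _ => ?_
      convert ih (Function.update ψ e (some o)) using 1 <;>
        refine integral_posteriorLaw_congr fun φ hφ => ?_
      · rw [dom_update, hφ.apply_of_update]
      · rw [dom_union_items_query _ hφ]

end Choice

end DecisionTree

open DecisionTree

section Greedy

variable {E O : Type*} [Fintype E] [DecidableEq E]
  (p : PMF (E → O)) (f : Finset E → (E → O) → ℝ≥0) (c : E → ℝ) (b : ℝ)
  (tie : PartialRealization E O → LinearOrder E)

/-- The item selected by the density-greedy rule on `S` after observing `ψ`, if any:
`greedyRule p f c b tie S ψ` is the point mass at it. -/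
noncomputable def greedyChoice (S : Finset E) (ψ : PartialRealization E O) : Option E :=
  if h : (bestCandidates p f c b S ψ).Nonempty then
    some (@Finset.min' E (tie ψ) (bestCandidates p f c b S ψ) h)
  else none

/-- The complete decision tree of the density-greedy rule on `S`. -/
noncomputable def greedyTree (S : Finset E) : DecisionTree E O :=
  ofChoice (greedyChoice p f c b tie S) (Fintype.card E) fun _ => none

variable {p f c b tie} {S : Finset E} {ψ : PartialRealization E O} {e o : E}

theorem mem_candidates :
    e ∈ candidates p f c b S ψ ↔
      e ∈ S ∧ e ∉ dom ψ ∧ c e ≤ b - ∑ e' ∈ dom ψ, c e' ∧ 0 < marginal p f e ψ := by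
  simp only [candidates, Finset.mem_filter, Finset.mem_sdiff, and_assoc]

theorem mem_bestCandidates :
    e ∈ bestCandidates p f c b S ψ ↔ e ∈ candidates p f c b S ψ ∧
      ∀ e' ∈ candidates p f c b S ψ, marginal p f e' ψ / c e' ≤ marginal p f e ψ / c e := by
  simp only [bestCandidates, Finset.mem_filter]

theorem greedyChoice_eq_some_iff :
    greedyChoice p f c b tie S ψ = some e ↔ e ∈ bestCandidates p f c b S ψ ∧
      ∀ e' ∈ bestCandidates p f c b S ψ, (tie ψ).le e e' := by
  let _ := tie ψ
  unfold greedyChoice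
  split_ifs with h
  · rw [Option.some_inj, Finset.min'_eq_iff]
  · exact iff_of_false nofun fun he => h ⟨e, he.1⟩

theorem exists_greedyChoice_eq_some (h : (candidates p f c b S ψ).Nonempty) :
    ∃ e, greedyChoice p f c b tie S ψ = some e := by
  obtain ⟨e, he, hmax⟩ := Finset.exists_max_image _ (fun e => marginal p f e ψ / c e) h
  exact ⟨_, dif_pos ⟨e, mem_bestCandidates.2 ⟨he, hmax⟩⟩⟩

theorem mem_bestCandidates_of_greedyChoice (h : greedyChoice p f c b tie S ψ = some e) :
    e ∈ bestCandidates p f c b S ψ :=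
  (greedyChoice_eq_some_iff.1 h).1

theorem mem_candidates_of_greedyChoice (h : greedyChoice p f c b tie S ψ = some e) :
    e ∈ S ∧ e ∉ dom ψ ∧ c e ≤ b - ∑ e' ∈ dom ψ, c e' ∧ 0 < marginal p f e ψ :=
  mem_candidates.1 (mem_bestCandidates.1 (mem_bestCandidates_of_greedyChoice h)).1

theorem greedyChoice_of_insert (h : greedyChoice p f c b tie (insert o S) ψ = some e)
    (heo : e ≠ o) : greedyChoice p f c b tie S ψ = some e := by
  rw [greedyChoice_eq_some_iff, mem_bestCandidates] at h ⊢
  obtain ⟨⟨he, hmax⟩, hmin⟩ := h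
  have hsub : candidates p f c b S ψ ⊆ candidates p f c b (insert o S) ψ := fun x hx =>
    mem_candidates.2 ((mem_candidates.1 hx).imp_left Finset.mem_insert_of_mem)
  have heS : e ∈ candidates p f c b S ψ :=
    mem_candidates.2 ((mem_candidates.1 he).imp_left fun h => Finset.mem_of_mem_insert_of_ne h heo)
  refine ⟨⟨heS, fun x hx => hmax x (hsub hx)⟩, fun x hx => hmin x ?_⟩
  obtain ⟨hxS, hxmax⟩ := mem_bestCandidates.1 hx
  exact mem_bestCandidates.2 ⟨hsub hxS, fun y hy => (hmax y hy).trans (hxmax e heS)⟩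

theorem greedyChoice_insert_cases (hc : ∀ e, 0 < c e) (ho : o ∉ dom ψ)
    (hfit : c o ≤ b - ∑ e ∈ dom ψ, c e) (hpos : 0 < marginal p f o ψ) :
    greedyChoice p f c b tie (insert o S) ψ = some o ∨
      ∃ e ≠ o, greedyChoice p f c b tie (insert o S) ψ = some e ∧
        greedyChoice p f c b tie S ψ = some e ∧
        marginal p f o ψ * c e ≤ marginal p f e ψ * c o := by
  have hcand : o ∈ candidates p f c b (insert o S) ψ :=
    mem_candidates.2 ⟨Finset.mem_insert_self _ _, ho, hfit, hpos⟩
  obtain ⟨e, he⟩ := exists_greedyChoice_eq_some (tie := tie) ⟨o, hcand⟩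
  obtain rfl | heo := eq_or_ne e o
  · exact .inl he
  · have hdensity := (mem_bestCandidates.1 (mem_bestCandidates_of_greedyChoice he)).2 o hcand
    rw [div_le_div_iff₀ (hc o) (hc e)] at hdensity
    exact .inr ⟨e, heo, he, greedyChoice_of_insert he heo, hdensity⟩

theorem queriesIn_greedyTree : (greedyTree p f c b tie S).QueriesIn S :=
  queriesIn_ofChoice (fun _ _ h => (mem_candidates_of_greedyChoice h).1) _ _

theorem sum_items_greedyTree_le (hb : 0 ≤ b) (φ : E → O) :
    ∑ e ∈ (greedyTree p f c b tie S).items φ, c e ≤ b := by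
  have h := sum_items_ofChoice_le (ψ := fun _ => none) (k := Fintype.card E)
    (choice := greedyChoice p f c b tie S) (c := c) (b := b) (fun ψ e h => ?_) (by simpa using hb) φ
  · rwa [dom_none, Finset.empty_union] at h
  · obtain ⟨-, hedom, hfit, -⟩ := mem_candidates_of_greedyChoice h
    rw [Finset.sum_insert hedom]
    linarith

theorem marginal_nonneg_of_greedyChoice (ψ : PartialRealization E O) (e : E)
    (h : greedyChoice p f c b tie S ψ = some e) : 0 ≤ marginal p f e ψ :=
  (mem_candidates_of_greedyChoice h).2.2.2.le

theorem itemGain_greedy_nonneg (k : ℕ) (ψ : PartialRealization E O) (φ : E → O) (o : E) :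
    0 ≤ itemGain p f (ofChoice (greedyChoice p f c b tie S) k ψ) ψ φ o :=
  itemGain_ofChoice_nonneg marginal_nonneg_of_greedyChoice k ψ φ o

-- The runs on `S` and on `insert o S` coincide until the latter selects `o`, which then gains at
-- least `δ`; as long as `o` fits into the budget but is not selected, every selected item has
-- density at least `δ / c o`.
theorem le_itemGain_insert_or_mul_le (hc : ∀ e, 0 < c e) {k : ℕ} {ψ : PartialRealization E O}
    {φ : E → O} (hψ : Consistent ψ φ) (hk : (dom ψ)ᶜ.card ≤ k) {B : Finset E}
    (hB : dom ψ ∪ (ofChoice (greedyChoice p f c b tie S) k ψ).items φ = B) (ho : o ∉ B)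
    {δ : ℝ} (hδ : 0 < δ)
    (hle : ∀ ψ', Consistent ψ' φ → dom ψ' ⊆ B → δ ≤ marginal p f o ψ') :
    δ ≤ itemGain p f (ofChoice (greedyChoice p f c b tie (insert o S)) k ψ) ψ φ o ∨
      δ * (b - ∑ e ∈ dom ψ, c e - c o) ≤
        c o * ∑ e, itemGain p f (ofChoice (greedyChoice p f c b tie S) k ψ) ψ φ e := by
  have hdom : dom ψ ⊆ B := hB ▸ Finset.subset_union_left
  have hodom : o ∉ dom ψ := fun h => ho (hdom h)
  have hδψ : δ ≤ marginal p f o ψ := hle ψ hψ hdom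
  by_cases hfit : c o ≤ b - ∑ e ∈ dom ψ, c e
  swap
  · refine .inr ((mul_nonpos_of_nonneg_of_nonpos hδ.le (by linarith)).trans ?_)
    exact mul_nonneg (hc o).le (Finset.sum_nonneg fun e _ => itemGain_greedy_nonneg k ψ φ e)
  cases k with
  | zero => exact absurd (Finset.card_pos.2 ⟨o, Finset.mem_compl.2 hodom⟩) hk.not_gt
  | succ k =>
    obtain he | ⟨e, heo, he, heS, hdensity⟩ := greedyChoice_insert_cases (tie := tie) (S := S) hc
      hodom hfit (hδ.trans_le hδψ)
    · left
      rw [ofChoice_succ_of_eq_some he, itemGain, if_pos rfl]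
      exact hδψ.trans (le_add_of_nonneg_right (itemGain_greedy_nonneg ..))
    · have hedom : e ∉ dom ψ := (mem_candidates_of_greedyChoice heS).2.1
      rw [ofChoice_succ_of_eq_some he, ofChoice_succ_of_eq_some heS, sum_itemGain_query, itemGain,
        if_neg heo.symm, zero_add]
      rw [dom_union_items_ofChoice_succ heS] at hB
      have hcard : (dom (Function.update ψ e (some (φ e))))ᶜ.card ≤ k := by
        rw [dom_update, Finset.compl_insert, Finset.card_erase_of_mem (Finset.mem_compl.2 hedom)]
        omega
      refine (le_itemGain_insert_or_mul_le hc (hψ.update e) hcard hB ho hδ hle).imp_right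
        fun hrest => ?_
      rw [dom_update, Finset.sum_insert hedom] at hrest
      have hδe : δ * c e ≤ c o * marginal p f e ψ :=
        (mul_le_mul_of_nonneg_right hδψ (hc e).le).trans (hdensity.trans_eq (mul_comm _ _))
      linarith

end Greedy

section GreedyGain

variable {E O : Type*} [Fintype E] [DecidableEq E]

/-- The conditional expected marginal utility of `o` at the moment when density-greedy on `S`
selects it under the realization `φ`, and `0` if `o` is never selected. -/
noncomputable def greedyGain (p : PMF (E → O)) (f : Finset E → (E → O) → ℝ≥0) (c : E → ℝ) (b : ℝ)
    (tie : PartialRealization E O → LinearOrder E) (S : Finset E) (φ : E → O) (o : E) : ℝ :=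
  itemGain p f (greedyTree p f c b tie S) (fun _ => none) φ o

variable {p : PMF (E → O)} {f : Finset E → (E → O) → ℝ≥0} {c : E → ℝ} {b : ℝ}
  {tie : PartialRealization E O → LinearOrder E} {S : Finset E} {φ : E → O} {o : E} {M : ℝ≥0}

theorem greedyGain_nonneg : 0 ≤ greedyGain p f c b tie S φ o :=
  itemGain_greedy_nonneg ..

theorem integrable_greedyGain (hM : ∀ e ψ, marginal p f e ψ ≤ M) (S : Finset E) (o : E) :
    Integrable (fun φ => greedyGain p f c b tie S φ o) p.toMeasure :=
  integrable_itemGain_ofChoice marginal_nonneg_of_greedyChoice hM ..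

theorem sum_integral_greedyGain_le_value (hint : ∀ S, expectedUtility p f S ≠ ⊤)
    (hM : ∀ e ψ, marginal p f e ψ ≤ M) (S : Finset E) :
    ∑ o, ∫ φ, greedyGain p f c b tie S φ o ∂p.toMeasure ≤
      (greedyTree p f c b tie S).value p f := by
  have h := integral_add_sum_itemGain_le (choice := greedyChoice p f c b tie S)
    marginal_nonneg_of_greedyChoice hint hM (Fintype.card E) fun _ => none
  simp only [dom_none, Finset.empty_union, posteriorLaw_none] at h
  rw [← integral_finsetSum _ fun o _ => integrable_greedyGain hM S o]
  refine (integral_mono (integrable_finsetSum _ fun o _ => integrable_greedyGain hM S o)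
    ((integrable_utility hint _).add
      (integrable_finsetSum _ fun o _ => integrable_greedyGain hM S o)) fun φ => ?_).trans h
  exact le_add_of_nonneg_left (NNReal.coe_nonneg (f ∅ φ))

theorem max_marginal_le (hf : AdaptiveSubmodular p f) (hc : ∀ e, 0 < c e)
    (hM : ∀ e ψ, marginal p f e ψ ≤ M) (hb : 0 < b) (hφ : p φ ≠ 0)
    (ho : o ∉ (greedyTree p f c b tie S).items φ) :
    max (marginal p f o (observe φ ((greedyTree p f c b tie S).items φ))) 0 ≤
      greedyGain p f c b tie (insert o S) φ o +
        c o * ((∑ e, greedyGain p f c b tie S φ e + M) / b) := by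
  set B := (greedyTree p f c b tie S).items φ with hB
  set δ := marginal p f o (observe φ B)
  have hsum : 0 ≤ ∑ e, greedyGain p f c b tie S φ e :=
    Finset.sum_nonneg fun e _ => greedyGain_nonneg
  have hcharge : 0 ≤ c o * ((∑ e, greedyGain p f c b tie S φ e + M) / b) := by
    have := hc o
    positivity
  obtain hδ | hδ := le_or_gt δ 0
  · rw [max_eq_right hδ]
    exact add_nonneg greedyGain_nonneg hcharge
  rw [max_eq_left hδ.le]
  obtain h | h := le_itemGain_insert_or_mul_le (b := b) (tie := tie) (S := S) hc
    (consistent_none φ) (Finset.card_le_univ _) (B := B) (by rw [dom_none, Finset.empty_union, hB,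
      greedyTree]) ho hδ fun ψ hψ hdom => hf ψ _ (hψ.subrealization_observe hdom)
        (probConsistent_pos (consistent_observe φ B) hφ) o (by rwa [dom_observe])
  · exact h.trans (le_add_of_nonneg_right hcharge)
  · refine le_add_of_nonneg_of_le greedyGain_nonneg ?_
    rw [dom_none, Finset.sum_empty, sub_zero] at h
    rw [← mul_div_assoc, le_div_iff₀ hb]
    calc δ * b = δ * (b - c o) + c o * δ := by ring
      _ ≤ c o * ∑ e, greedyGain p f c b tie S φ e + c o * M :=
        add_le_add h (mul_le_mul_of_nonneg_left (hM o _) (hc o).le)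
      _ = _ := (mul_add ..).symm

theorem sum_max_marginal_le (hf : AdaptiveSubmodular p f) (hc : ∀ e, 0 < c e)
    (hM : ∀ e ψ, marginal p f e ψ ≤ M) (hφ : p φ ≠ 0) {R : Finset E} (hR : ∑ e ∈ R, c e ≤ b) :
    ∑ o ∈ R \ (greedyTree p f c b tie S).items φ,
        max (marginal p f o (observe φ ((greedyTree p f c b tie S).items φ))) 0 ≤
      ∑ o, greedyGain p f c b tie (insert o S) φ o + ∑ o, greedyGain p f c b tie S φ o + M := by
  set B := (greedyTree p f c b tie S).items φ
  set q := ∑ o, greedyGain p f c b tie S φ o + M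
  have hq : 0 ≤ q := add_nonneg (Finset.sum_nonneg fun _ _ => greedyGain_nonneg) M.2
  rw [add_assoc]
  obtain hempty | ⟨o, ho⟩ := (R \ B).eq_empty_or_nonempty
  · rw [hempty, Finset.sum_empty]
    exact add_nonneg (Finset.sum_nonneg fun _ _ => greedyGain_nonneg) hq
  have hcost : ∑ o ∈ R \ B, c o ≤ b :=
    (Finset.sum_le_sum_of_subset_of_nonneg Finset.sdiff_subset fun o _ _ => (hc o).le).trans hR
  have hb : 0 < b := (Finset.sum_pos (fun o _ => hc o) ⟨o, ho⟩).trans_le hcost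
  calc ∑ o ∈ R \ B, max (marginal p f o (observe φ B)) 0
      ≤ ∑ o ∈ R \ B, (greedyGain p f c b tie (insert o S) φ o + c o * (q / b)) :=
        Finset.sum_le_sum fun o ho => max_marginal_le hf hc hM hb hφ (Finset.mem_sdiff.1 ho).2
    _ = ∑ o ∈ R \ B, greedyGain p f c b tie (insert o S) φ o + (∑ o ∈ R \ B, c o) * (q / b) := by
        rw [Finset.sum_add_distrib, Finset.sum_mul]
    _ ≤ ∑ o, greedyGain p f c b tie (insert o S) φ o + b * (q / b) := by
        gcongr
        exacts [fun _ _ _ => greedyGain_nonneg, Finset.subset_univ _]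
    _ = ∑ o, greedyGain p f c b tie (insert o S) φ o + q := by rw [mul_div_cancel₀ _ hb.ne']

variable {t : DecisionTree E O}

theorem integral_greedyTree_union_le (hint : ∀ S, expectedUtility p f S ≠ ⊤)
    (hf : AdaptiveSubmodular p f) (hc : ∀ e, 0 < c e) (hM : ∀ e ψ, marginal p f e ψ ≤ M)
    (ht : ∀ φ, p φ ≠ 0 → ∑ e ∈ t.items φ, c e ≤ b) (S : Finset E) :
    ∫ φ, (f ((greedyTree p f c b tie S).items φ ∪ t.items φ) φ : ℝ) ∂p.toMeasure ≤
      2 * (greedyTree p f c b tie S).value p f +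
        ∑ o, ∫ φ, greedyGain p f c b tie (insert o S) φ o ∂p.toMeasure + M := by
  have hunion := integral_union_le_add_sum hint hf (greedyTree p f c b tie S) t fun _ => none
  simp only [dom_none, Finset.empty_union, posteriorLaw_none] at hunion
  have hI := integrable_utility (p := p) hint (greedyTree p f c b tie S).items
  have hgain (S' : E → Finset E) :
      Integrable (fun φ => ∑ o, greedyGain p f c b tie (S' o) φ o) p.toMeasure :=
    integrable_finsetSum _ fun o _ => integrable_greedyGain hM (S' o) o
  have hgains := ((hgain fun o => insert o S).add (hgain fun _ => S)).add
    (integrable_const (M : ℝ))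
  have hmono := integral_mono_ae
    (hI.add (integrable_sum_mem (hf.integrable_max_marginal hint _) _)) (hI.add hgains)
    ((ae_toMeasure_apply_ne_zero p).mono fun φ hφ =>
      add_le_add_right (sum_max_marginal_le (tie := tie) hf hc hM hφ (ht φ hφ)) _)
  refine hunion.trans (hmono.trans ?_)
  rw [integral_add' hI hgains, integral_add' ((hgain _).add (hgain _)) (integrable_const _),
    integral_add' (hgain _) (hgain _), integral_const, probReal_univ, one_smul,
    integral_finsetSum _ fun o _ => integrable_greedyGain hM _ o,
    integral_finsetSum _ fun o _ => integrable_greedyGain hM _ o]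
  have hS := sum_integral_greedyGain_le_value (c := c) (b := b) (tie := tie) hint hM S
  rw [DecisionTree.value] at hS ⊢
  linarith

theorem value_le_integral_greedyTree_union_add (hint : ∀ S, expectedUtility p f S ≠ ⊤)
    (hf : AdaptiveSubmodular p f) (S : Finset E) :
    t.value p f ≤
      ∫ φ, (f ((greedyTree p f c b tie S).items φ ∪ t.items φ) φ : ℝ) ∂p.toMeasure +
        ∫ φ, (f ((greedyTree p f c b tie Sᶜ).items φ ∪ t.items φ) φ : ℝ) ∂p.toMeasure := by
  have h := integral_items_le_add hint hf disjoint_compl_right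
    (g := greedyTree p f c b tie S) (g' := greedyTree p f c b tie Sᶜ)
    queriesIn_greedyTree queriesIn_greedyTree t fun _ => none
  simp only [dom_none, Finset.empty_union, posteriorLaw_none, Finset.union_comm (t.items _)] at h
  rwa [integral_add (integrable_utility hint _) (integrable_utility hint _)] at h

end GreedyGain

section RandomSubset

variable {E : Type*} [Fintype E] [DecidableEq E] {δ : ℝ≥0} (hδ : δ ≤ 1)

theorem toReal_randomSubset_apply (S : Finset E) :
    (randomSubset E δ hδ S).toReal = (δ : ℝ) ^ S.card * (1 - δ : ℝ) ^ Sᶜ.card := by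
  rw [randomSubset, PMF.ofFintype_apply, Finset.prod_const, Finset.prod_const, ENNReal.coe_toReal,
    NNReal.coe_mul, NNReal.coe_pow, NNReal.coe_pow, NNReal.coe_sub hδ, NNReal.coe_one]

theorem integral_randomSubset_compl (F : Finset E → ℝ) :
    ∫ S, F Sᶜ ∂(randomSubset E δ hδ).toMeasure =
      ∫ S, F S ∂(randomSubset E (1 - δ) tsub_le_self).toMeasure := by
  rw [PMF.integral_eq_sum, PMF.integral_eq_sum, ← (compl_bijective (α := Finset E)).sum_comp]
  refine Finset.sum_congr rfl fun S _ => ?_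
  simp only [toReal_randomSubset_apply, NNReal.coe_sub hδ, NNReal.coe_one, sub_sub_cancel,
    compl_compl, mul_comm]

theorem mul_integral_randomSubset_insert_le {F : Finset E → ℝ} (hF : ∀ S, 0 ≤ F S) (o : E) :
    δ * ∫ S, F (insert o S) ∂(randomSubset E δ hδ).toMeasure ≤
      ∫ S, F S ∂(randomSubset E δ hδ).toMeasure := by
  set w : Finset E → ℝ := fun S => (randomSubset E δ hδ S).toReal
  have ho : o ∉ Finset.univ.erase o := Finset.notMem_erase o _
  have hsplit (H : Finset E → ℝ) : ∫ S, H S ∂(randomSubset E δ hδ).toMeasure =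
      ∑ S ∈ (Finset.univ.erase o).powerset, (w S * H S + w (insert o S) * H (insert o S)) := by
    rw [PMF.integral_eq_sum, Finset.sum_add_distrib, ← Finset.sum_powerset_insert ho,
      Finset.insert_erase (Finset.mem_univ o), Finset.powerset_univ]
    rfl
  rw [hsplit, hsplit, Finset.mul_sum]
  refine Finset.sum_le_sum fun S hS => ?_
  have hoS : o ∉ S := fun h => ho (Finset.mem_powerset.1 hS h)
  have hw : δ * (w S + w (insert o S)) = w (insert o S) := by
    simp only [w, toReal_randomSubset_apply, Finset.card_insert_of_notMem hoS,
      Finset.compl_insert]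
    rw [← Finset.card_erase_add_one (Finset.mem_compl.2 hoS)]
    ring
  calc δ * (w S * F (insert o S) + w (insert o S) * F (insert o (insert o S)))
      = w (insert o S) * F (insert o S) := by rw [Finset.insert_idem, ← add_mul, ← mul_assoc, hw]
    _ ≤ w S * F S + w (insert o S) * F (insert o S) :=
      le_add_of_nonneg_left (mul_nonneg ENNReal.toReal_nonneg (hF S))

end RandomSubset

section Average

variable {E O : Type*} [Fintype E] [DecidableEq E]
  {p : PMF (E → O)} {f : Finset E → (E → O) → ℝ≥0} {c : E → ℝ} {b : ℝ}
  {tie : PartialRealization E O → LinearOrder E} {t : DecisionTree E O} {M δ : ℝ≥0}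

theorem integral_sum_greedyGain_insert_le (hint : ∀ S, expectedUtility p f S ≠ ⊤)
    (hM : ∀ e ψ, marginal p f e ψ ≤ M) (hδ : δ ≤ 1) (hδ₀ : δ ≠ 0) :
    ∫ S, ∑ o, ∫ φ, greedyGain p f c b tie (insert o S) φ o ∂p.toMeasure
        ∂(randomSubset E δ hδ).toMeasure ≤
      (δ : ℝ)⁻¹ * ∫ S, (greedyTree p f c b tie S).value p f ∂(randomSubset E δ hδ).toMeasure := by
  let gain (o : E) (S : Finset E) : ℝ := ∫ φ, greedyGain p f c b tie S φ o ∂p.toMeasure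
  have hgain (o : E) (S : Finset E) : 0 ≤ gain o S := integral_nonneg fun _ => greedyGain_nonneg
  rw [le_inv_mul_iff₀ (NNReal.coe_pos.2 (pos_iff_ne_zero.2 hδ₀)),
    integral_finsetSum _ fun _ _ => .of_finite, Finset.mul_sum]
  calc ∑ o, δ * ∫ S, gain o (insert o S) ∂(randomSubset E δ hδ).toMeasure
      ≤ ∑ o, ∫ S, gain o S ∂(randomSubset E δ hδ).toMeasure :=
        Finset.sum_le_sum fun o _ => mul_integral_randomSubset_insert_le hδ (hgain o) o
    _ = ∫ S, ∑ o, gain o S ∂(randomSubset E δ hδ).toMeasure :=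
        (integral_finsetSum _ fun _ _ => .of_finite).symm
    _ ≤ ∫ S, (greedyTree p f c b tie S).value p f ∂(randomSubset E δ hδ).toMeasure :=
        integral_mono .of_finite .of_finite fun S => sum_integral_greedyGain_le_value hint hM S

theorem integral_integral_greedyTree_union_le (hint : ∀ S, expectedUtility p f S ≠ ⊤)
    (hf : AdaptiveSubmodular p f) (hc : ∀ e, 0 < c e) (hM : ∀ e ψ, marginal p f e ψ ≤ M)
    (ht : ∀ φ, p φ ≠ 0 → ∑ e ∈ t.items φ, c e ≤ b) (hδ : δ ≤ 1) (hδ₀ : δ ≠ 0) :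
    ∫ S, ∫ φ, (f ((greedyTree p f c b tie S).items φ ∪ t.items φ) φ : ℝ) ∂p.toMeasure
        ∂(randomSubset E δ hδ).toMeasure ≤
      (2 + (δ : ℝ)⁻¹) * ∫ S, (greedyTree p f c b tie S).value p f
        ∂(randomSubset E δ hδ).toMeasure + M := by
  have h := integral_mono (μ := (randomSubset E δ hδ).toMeasure) .of_finite .of_finite
    fun S => integral_greedyTree_union_le (tie := tie) hint hf hc hM ht S
  rw [integral_add .of_finite .of_finite, integral_add .of_finite .of_finite,
    integral_const_mul, integral_const, probReal_univ, one_smul] at h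
  have hinsert := integral_sum_greedyGain_insert_le (c := c) (b := b) (tie := tie) hint hM hδ hδ₀
  linarith

theorem value_le_integral_greedyTree (hint : ∀ S, expectedUtility p f S ≠ ⊤)
    (hf : AdaptiveSubmodular p f) (hc : ∀ e, 0 < c e) (hM : ∀ e ψ, marginal p f e ψ ≤ M)
    (ht : ∀ φ, p φ ≠ 0 → ∑ e ∈ t.items φ, c e ≤ b) (hδ₀ : δ ≠ 0) (hδ : δ < 1) :
    t.value p f ≤
      (2 + (δ : ℝ)⁻¹) * ∫ S, (greedyTree p f c b tie S).value p f
          ∂(randomSubset E δ hδ.le).toMeasure +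
        (2 + (1 - δ : ℝ)⁻¹) * ∫ S, (greedyTree p f c b tie Sᶜ).value p f
          ∂(randomSubset E δ hδ.le).toMeasure + 2 * M := by
  set W := fun S : Finset E =>
    ∫ φ, (f ((greedyTree p f c b tie S).items φ ∪ t.items φ) φ : ℝ) ∂p.toMeasure
  have hW : t.value p f ≤ ∫ S, W S ∂(randomSubset E δ hδ.le).toMeasure +
      ∫ S, W Sᶜ ∂(randomSubset E δ hδ.le).toMeasure := by
    rw [← integral_add .of_finite .of_finite]
    have := integral_mono (μ := (randomSubset E δ hδ.le).toMeasure) (.of_finite) (.of_finite)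
      fun S => value_le_integral_greedyTree_union_add (c := c) (b := b) (tie := tie) (t := t)
        hint hf S
    rwa [integral_const, probReal_univ, one_smul] at this
  have hS := integral_integral_greedyTree_union_le (tie := tie) hint hf hc hM ht hδ.le hδ₀
  have hSc := integral_integral_greedyTree_union_le (tie := tie) hint hf hc hM ht
    (tsub_le_self : 1 - δ ≤ 1) (tsub_pos_of_lt hδ).ne'
  rw [NNReal.coe_sub hδ.le, NNReal.coe_one] at hSc
  rw [integral_randomSubset_compl hδ.le] at hW
  rw [integral_randomSubset_compl hδ.le fun S => (greedyTree p f c b tie S).value p f]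
  linarith

end Average

section ExpectedUtility

theorem integral_toMeasure_bind {α β : Type*} [Fintype α] [Finite β] [MeasurableSpace β]
    [DiscreteMeasurableSpace β] (μ : PMF α) (κ : α → PMF β) (X : β → ℝ) :
    ∫ b, X b ∂(μ.bind κ).toMeasure = ∑ a, (μ a).toReal * ∫ b, X b ∂(κ a).toMeasure := by
  have := Fintype.ofFinite β
  simp only [PMF.integral_eq_sum, PMF.bind_apply, tsum_fintype, smul_eq_mul, Finset.mul_sum]
  rw [Finset.sum_comm]
  refine Finset.sum_congr rfl fun b _ => ?_
  rw [ENNReal.toReal_sum fun a _ => ENNReal.mul_ne_top (μ.apply_ne_top a) ((κ a).apply_ne_top b),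
    Finset.sum_mul]
  simp only [ENNReal.toReal_mul, mul_assoc]

variable {E O : Type*} {p : PMF (E → O)} {f : Finset E → (E → O) → ℝ≥0}

/-- The conditional expected utility `𝔼[f(S, Φ) ∣ ψ ≺ Φ]` of a random set `S` whose law under the
realization `φ` is `L φ`. -/
noncomputable def condUtility (p : PMF (E → O)) (f : Finset E → (E → O) → ℝ≥0)
    (ψ : PartialRealization E O) (L : (E → O) → PMF (Finset E)) : ℝ :=
  ∫ φ, ∫ S, (f S φ : ℝ) ∂(L φ).toMeasure ∂posteriorLaw p ψ

theorem integrable_integral_utility [Finite E] (hint : ∀ S, expectedUtility p f S ≠ ⊤)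
    (L : (E → O) → PMF (Finset E)) :
    Integrable (fun φ => ∫ S, (f S φ : ℝ) ∂(L φ).toMeasure) p.toMeasure := by
  have := Fintype.ofFinite E
  refine (integrable_finsetSum Finset.univ fun S _ => integrable_utility hint fun _ => S).mono'
    Measurable.of_discrete.aestronglyMeasurable (.of_forall fun φ => ?_)
  rw [Real.norm_of_nonneg (integral_nonneg fun _ => NNReal.coe_nonneg _), PMF.integral_eq_sum]
  exact Finset.sum_le_sum fun S _ => mul_le_of_le_one_left (NNReal.coe_nonneg _)
    (ENNReal.toReal_mono ENNReal.one_ne_top ((L φ).coe_le_one S))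

theorem condUtility_bind [Finite E] (hint : ∀ S, expectedUtility p f S ≠ ⊤) {α : Type*} [Fintype α]
    (μ : PMF α) (L : α → (E → O) → PMF (Finset E)) (ψ : PartialRealization E O) :
    condUtility p f ψ (fun φ => μ.bind fun a => L a φ) =
      ∑ a, (μ a).toReal * condUtility p f ψ (L a) := by
  simp only [condUtility, integral_toMeasure_bind]
  rw [integral_finsetSum _ fun a _ =>
    (integrable_posteriorLaw (integrable_integral_utility hint (L a)) ψ).const_mul _]
  simp only [integral_const_mul]

theorem condUtility_eq_of_pure [Finite E] {ψ : PartialRealization E O}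
    {L : (E → O) → PMF (Finset E)} {B : (E → O) → Finset E}
    (h : ∀ φ, Consistent ψ φ → L φ = PMF.pure (B φ)) :
    condUtility p f ψ L = ∫ φ, (f (B φ) φ : ℝ) ∂posteriorLaw p ψ :=
  integral_posteriorLaw_congr fun φ hφ => by
    rw [h φ hφ, PMF.toMeasure_pure, integral_dirac]

variable [Fintype E] [DecidableEq E]

theorem favg_eq_condUtility (hint : ∀ S, expectedUtility p f S ≠ ⊤) (π : Policy E O) :
    favg p f π = ENNReal.ofReal (condUtility p f (fun _ => none) (selected π)) := by
  rw [condUtility, posteriorLaw_none, ofReal_integral_eq_lintegral_ofReal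
    (integrable_integral_utility hint _)
    (.of_forall fun φ => integral_nonneg fun _ => NNReal.coe_nonneg _), lintegral_toMeasure, favg]
  refine tsum_congr fun φ => ?_
  rw [PMF.integral_eq_sum, ENNReal.ofReal_sum_of_nonneg fun S _ =>
    smul_nonneg ENNReal.toReal_nonneg (NNReal.coe_nonneg _)]
  simp only [smul_eq_mul, ENNReal.ofReal_mul ENNReal.toReal_nonneg,
    ENNReal.ofReal_toReal (PMF.apply_ne_top _ _), ENNReal.ofReal_coe_nnreal]

theorem favg_eq_of_selected_eq_pure (hint : ∀ S, expectedUtility p f S ≠ ⊤) {π : Policy E O}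
    {B : (E → O) → Finset E} (h : ∀ φ, selected π φ = PMF.pure (B φ)) :
    favg p f π = ENNReal.ofReal (∫ φ, (f (B φ) φ : ℝ) ∂p.toMeasure) := by
  rw [favg_eq_condUtility hint, condUtility_eq_of_pure fun φ _ => h φ, posteriorLaw_none]

theorem selected_pure (r : Rule E O) (φ : E → O) :
    selected (PMF.pure r) φ = runFrom r φ (Fintype.card E) fun _ => none :=
  PMF.pure_bind ..

theorem favg_bind {α : Type*} (μ : PMF α) (κ : α → Policy E O) :
    favg p f (μ.bind κ) = ∑' a, μ a * favg p f (κ a) := by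
  have hsel (φ : E → O) (S : Finset E) :
      selected (μ.bind κ) φ S = ∑' a, μ a * selected (κ a) φ S := by
    simp only [selected, PMF.bind_bind, PMF.bind_apply]
  simp only [favg, hsel, ← ENNReal.tsum_mul_left, ← tsum_fintype (L := .unconditional _),
    ← ENNReal.tsum_mul_right]
  rw [ENNReal.tsum_comm (α := α)]
  refine tsum_congr fun φ => ?_
  rw [ENNReal.tsum_comm]
  refine tsum_congr fun a => tsum_congr fun S => ?_
  ring

end ExpectedUtility

section Derandomization

variable {E O : Type*} [Fintype E] [DecidableEq E]
  {p : PMF (E → O)} {f : Finset E → (E → O) → ℝ≥0}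

theorem exists_decisionTree_condUtility_le (hint : ∀ S, expectedUtility p f S ≠ ⊤) (r : Rule E O)
    (k : ℕ) (ψ : PartialRealization E O) :
    ∃ t : DecisionTree E O,
      (∀ φ, Consistent ψ φ → dom ψ ∪ t.items φ ∈ (runFrom r φ k ψ).support) ∧
      condUtility p f ψ (fun φ => runFrom r φ k ψ) ≤
        ∫ φ, (f (dom ψ ∪ t.items φ) φ : ℝ) ∂posteriorLaw p ψ := by
  induction k generalizing ψ with
  | zero =>
    refine ⟨.leaf, fun φ _ => ?_, (condUtility_eq_of_pure fun φ _ => ?_).le⟩ <;>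
      simp [runFrom, items]
  | succ k ih =>
    let branch (a : Option E) (φ : E → O) : PMF (Finset E) :=
      match a with
      | none => PMF.pure (dom ψ)
      | some e => runFrom r φ k (Function.update ψ e (some (φ e)))
    obtain ⟨a, ha, hle⟩ : ∃ a ∈ (r ψ).support,
        condUtility p f ψ (fun φ => runFrom r φ (k + 1) ψ) ≤ condUtility p f ψ (branch a) := by
      let _ : MeasurableSpace (Option E) := ⊤
      have hbind := condUtility_bind hint (r ψ) branch ψ
      simp only [← smul_eq_mul, ← PMF.integral_eq_sum] at hbind
      exact hbind ▸ exists_mem_support_integral_le (r ψ) .of_finite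
    suffices h : ∃ t : DecisionTree E O,
        (∀ φ, Consistent ψ φ → dom ψ ∪ t.items φ ∈ (branch a φ).support) ∧
        condUtility p f ψ (branch a) ≤
          ∫ φ, (f (dom ψ ∪ t.items φ) φ : ℝ) ∂posteriorLaw p ψ by
      obtain ⟨t, hmem, hval⟩ := h
      exact ⟨t, fun φ hφ => (PMF.mem_support_bind_iff ..).2 ⟨a, ha, hmem φ hφ⟩, hle.trans hval⟩
    cases a with
    | none =>
      refine ⟨.leaf, fun φ _ => ?_, (condUtility_eq_of_pure fun φ _ => ?_).le⟩ <;>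
        simp [branch, items]
    | some e =>
      choose next hmem hval using fun o => ih (Function.update ψ e (some o))
      refine ⟨.query e next, fun φ hφ => ?_, ?_⟩
      · rw [dom_union_items_query next (hφ.update e)]
        exact hmem (φ e) φ (hφ.update e)
      · refine integral_posteriorLaw_le_of_update (integrable_integral_utility hint _)
          (integrable_utility hint _) e fun o _ _ => ?_
        convert hval o using 1 <;> refine integral_posteriorLaw_congr fun φ hφ => ?_
        · simp only [branch, hφ.apply_of_update]
        · rw [dom_union_items_query next hφ]

theorem exists_mem_support_favg_le (hint : ∀ S, expectedUtility p f S ≠ ⊤) (π : Policy E O) :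
    ∃ r ∈ π.support, favg p f π ≤ favg p f (PMF.pure r) := by
  let _ : MeasurableSpace (Rule E O) := ⊤
  have hmean : ∫⁻ r, favg p f (PMF.pure r) ∂π.toMeasure = favg p f π := by
    rw [lintegral_toMeasure, ← favg_bind, PMF.bind_pure]
  have hfinite : favg p f π ≠ ⊤ := favg_eq_condUtility hint π ▸ ENNReal.ofReal_ne_top
  obtain ⟨r, hr, hle⟩ := exists_notMem_null_lintegral_le (hmean ▸ hfinite)
    (ae_toMeasure_apply_ne_zero π)
  exact ⟨r, (π.mem_support_iff r).2 (not_not.1 hr), hmean ▸ hle⟩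

theorem Feasible.exists_decisionTree_favg_le (hint : ∀ S, expectedUtility p f S ≠ ⊤) {c : E → ℝ}
    {b : ℝ} {π : Policy E O} (hπ : Feasible p c b π) :
    ∃ t : DecisionTree E O, (∀ φ, p φ ≠ 0 → ∑ e ∈ t.items φ, c e ≤ b) ∧
      favg p f π ≤ ENNReal.ofReal (t.value p f) := by
  obtain ⟨r, hr, hrule⟩ := exists_mem_support_favg_le hint π
  obtain ⟨t, hmem, hval⟩ := exists_decisionTree_condUtility_le (p := p) hint r (Fintype.card E)
    fun _ => none
  simp only [dom_none, Finset.empty_union, posteriorLaw_none] at hmem hval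
  refine ⟨t, fun φ hφ => ?_, hrule.trans ?_⟩
  · have hsel : t.items φ ∈ (selected π φ).support :=
      (PMF.mem_support_bind_iff ..).2 ⟨r, hr, hmem φ (consistent_none φ)⟩
    exact hπ φ (pos_iff_ne_zero.2 hφ) _ (pos_iff_ne_zero.2 ((PMF.mem_support_iff ..).1 hsel))
  · rw [favg_eq_condUtility hint, funext (selected_pure r)]
    exact ENNReal.ofReal_le_ofReal hval

end Derandomization

section Sad

variable {E O : Type*} [Fintype E] [DecidableEq E]
  {p : PMF (E → O)} {f : Finset E → (E → O) → ℝ≥0} {c : E → ℝ} {b : ℝ}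
  {tie : PartialRealization E O → LinearOrder E}

theorem selected_singletonRule (e : E) (φ : E → O) :
    selected (PMF.pure (singletonRule e)) φ = PMF.pure {e} := by
  have : Nonempty E := ⟨e⟩
  obtain ⟨k, hk⟩ := Nat.exists_eq_succ_of_ne_zero (Fintype.card_ne_zero (α := E))
  rw [selected_pure, hk]
  cases k <;> simp [runFrom, singletonRule, PMF.pure_bind]

theorem selected_greedyRule (S : Finset E) (φ : E → O) :
    selected (PMF.pure (greedyRule p f c b tie S)) φ =
      PMF.pure ((greedyTree p f c b tie S).items φ) := by
  have h := runFrom_pure_choice (choice := greedyChoice p f c b tie S) φ (Fintype.card E)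
    fun _ => none
  rw [dom_none, Finset.empty_union] at h
  exact (selected_pure _ φ).trans h

variable {estar : E} {δ₀ δ₁ δ₂ : ℝ≥0} (h₀ : δ₀ ≤ 1) (h₁₂ : δ₁ + δ₂ ≤ 1)

theorem feasible_sad (hb : 0 ≤ b) (hestar : c estar ≤ b) :
    Feasible p c b (sad p f c b tie estar δ₀ δ₁ δ₂ h₀ h₁₂) := by
  intro φ _ S hS
  have hgreedy (S₁ : Finset E)
      (hS : S ∈ (selected (PMF.pure (greedyRule p f c b tie S₁)) φ).support) :
      ∑ e ∈ S, c e ≤ b := by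
    rw [selected_greedyRule, PMF.support_pure, Set.mem_singleton_iff] at hS
    exact hS ▸ sum_items_greedyTree_le hb φ
  obtain ⟨r, hr, hS⟩ := (PMF.mem_support_bind_iff ..).1 ((PMF.mem_support_iff ..).2 hS.ne')
  rw [← selected_pure] at hS
  obtain ⟨i, -, hr⟩ := (PMF.mem_support_bind_iff ..).1 hr
  obtain ⟨S₁, -, rfl⟩ := (PMF.mem_support_map_iff ..).1 hr
  fin_cases i
  · rw [Fin.zero_eta, Matrix.cons_val_zero, selected_singletonRule, PMF.support_pure,
      Set.mem_singleton_iff] at hS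
    rwa [hS, Finset.sum_singleton]
  · exact hgreedy S₁ hS
  · exact hgreedy S₁ᶜ hS

theorem favg_map_randomSubset {r : Finset E → Rule E O} {v : Finset E → ℝ} (hv : ∀ S, 0 ≤ v S)
    (hr : ∀ S, favg p f (PMF.pure (r S)) = ENNReal.ofReal (v S)) :
    favg p f ((randomSubset E δ₀ h₀).map r) =
      ENNReal.ofReal (∫ S, v S ∂(randomSubset E δ₀ h₀).toMeasure) := by
  rw [← PMF.bind_pure_comp, favg_bind, ofReal_integral_eq_lintegral_ofReal .of_finite
    (.of_forall hv), lintegral_toMeasure]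
  simp only [Function.comp_apply, hr]

theorem favg_sad (hint : ∀ S, expectedUtility p f S ≠ ⊤) :
    favg p f (sad p f c b tie estar δ₀ δ₁ δ₂ h₀ h₁₂) =
      ENNReal.ofReal (δ₁ * (expectedUtility p f {estar}).toReal +
        δ₂ * ∫ S, (greedyTree p f c b tie S).value p f ∂(randomSubset E δ₀ h₀).toMeasure +
        (1 - (δ₁ + δ₂)) *
          ∫ S, (greedyTree p f c b tie Sᶜ).value p f ∂(randomSubset E δ₀ h₀).toMeasure) := by
  have hsingle : favg p f ((randomSubset E δ₀ h₀).map fun _ => singletonRule estar) =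
      ENNReal.ofReal (expectedUtility p f {estar}).toReal := by
    rw [toReal_expectedUtility, ← favg_eq_of_selected_eq_pure hint (selected_singletonRule estar)]
    exact congrArg _ (PMF.map_const ..)
  have hgreedy (S : Finset E) : favg p f (PMF.pure (greedyRule p f c b tie S)) =
      ENNReal.ofReal ((greedyTree p f c b tie S).value p f) :=
    favg_eq_of_selected_eq_pure hint (selected_greedyRule S)
  have hrest : (1 : ℝ) - (δ₁ + δ₂) = (1 - (δ₁ + δ₂) : ℝ≥0) := by
    rw [NNReal.coe_sub h₁₂, NNReal.coe_add, NNReal.coe_one]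
  have hS : 0 ≤ ∫ S, (greedyTree p f c b tie S).value p f ∂(randomSubset E δ₀ h₀).toMeasure :=
    integral_nonneg fun _ => value_nonneg _
  have hSc : 0 ≤ ∫ S, (greedyTree p f c b tie Sᶜ).value p f ∂(randomSubset E δ₀ h₀).toMeasure :=
    integral_nonneg fun _ => value_nonneg _
  rw [sad, favg_bind, tsum_fintype, Fin.sum_univ_three, hrest]
  simp only [policyIndex, PMF.ofFintype_apply, Matrix.cons_val_zero, Matrix.cons_val_one,
    Matrix.cons_val_two, Matrix.head_cons, Matrix.tail_cons, hsingle,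
    favg_map_randomSubset h₀ (fun _ => value_nonneg _) hgreedy,
    favg_map_randomSubset h₀ (fun _ => value_nonneg _) fun S => hgreedy Sᶜ]
  have hfixed : 0 ≤ (δ₁ : ℝ) * (expectedUtility p f {estar}).toReal := by positivity
  rw [ENNReal.ofReal_add (add_nonneg hfixed (by positivity)) (by positivity),
    ENNReal.ofReal_add hfixed (by positivity)]
  simp only [ENNReal.ofReal_mul (NNReal.coe_nonneg _), ENNReal.ofReal_coe_nnreal]

end Sad

end AdaptiveKnapsack

open AdaptiveKnapsack in
theorem mainTheorem1_general {E O : Type*} [Fintype E] [DecidableEq E]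
    {p : PMF (E → O)} {f : Finset E → (E → O) → ℝ≥0} (hint : ∀ S, expectedUtility p f S ≠ ⊤)
    (hf : AdaptiveSubmodular p f) {c : E → ℝ} (hc : ∀ e, 0 < c e) {b : ℝ}
    {tie : PartialRealization E O → LinearOrder E} {estar : E}
    (hstar : ∀ e, expectedUtility p f {e} ≤ expectedUtility p f {estar}) {δ₀ δ₁ δ₂ : ℝ≥0}
    (hδ₀ : δ₀ ≠ 0) (hδ₀' : δ₀ < 1) (h₁₂ : δ₁ + δ₂ ≤ 1) {α : ℝ≥0} (hα₁ : α * 2 ≤ (δ₁ : ℝ))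
    (hα₂ : α * (2 + (δ₀ : ℝ)⁻¹) ≤ δ₂) (hα₃ : α * (2 + (1 - δ₀ : ℝ)⁻¹) ≤ 1 - (δ₁ + δ₂)) :
    (c estar ≤ b → Feasible p c b (sad p f c b tie estar δ₀ δ₁ δ₂ hδ₀'.le h₁₂)) ∧
    ∀ π : Policy E O, Feasible p c b π →
      α * favg p f π ≤ favg p f (sad p f c b tie estar δ₀ δ₁ δ₂ hδ₀'.le h₁₂) := by
  refine ⟨fun h => feasible_sad _ _ ((hc estar).le.trans h) h, fun π hπ => ?_⟩
  obtain ⟨t, ht, hle⟩ := hπ.exists_decisionTree_favg_le hint (f := f)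
  have hM (e ψ) : marginal p f e ψ ≤ (expectedUtility p f {estar}).toNNReal :=
    (hf.marginal_le hint e ψ).trans (ENNReal.toReal_mono (hint _) (hstar e))
  refine (mul_le_mul_right hle _).trans ?_
  rw [favg_sad _ _ hint, ← ENNReal.ofReal_coe_nnreal, ← ENNReal.ofReal_mul (NNReal.coe_nonneg α)]
  have hbound := mul_le_mul_of_nonneg_left
    (value_le_integral_greedyTree (tie := tie) hint hf hc hM ht hδ₀ hδ₀') (NNReal.coe_nonneg α)
  refine ENNReal.ofReal_le_ofReal (hbound.trans ?_)
  have hnonneg (S : Finset E → Finset E) : 0 ≤ ∫ S₁, (greedyTree p f c b tie (S S₁)).value p f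
      ∂(randomSubset E δ₀ hδ₀'.le).toMeasure :=
    MeasureTheory.integral_nonneg fun _ => DecisionTree.value_nonneg _
  rw [ENNReal.coe_toNNReal_eq_toReal, mul_add, mul_add, ← mul_assoc, ← mul_assoc, ← mul_assoc,
    ← add_rotate]
  gcongr
  · exact hnonneg id
  · exact hnonneg compl

theorem mainTheorem1 {E O : Type*} [Fintype E] [DecidableEq E]
    (p : PMF (E → O)) (f : Finset E → (E → O) → ℝ≥0)
    (hint : ∀ S, AdaptiveKnapsack.expectedUtility p f S ≠ ⊤)
    (hf : AdaptiveKnapsack.AdaptiveSubmodular p f)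
    (c : E → ℝ) (hc : ∀ e, 0 < c e) (b : ℝ)
    (tie : AdaptiveKnapsack.PartialRealization E O → LinearOrder E)
    (estar : E)
    (hstar : ∀ e, AdaptiveKnapsack.expectedUtility p f {e} ≤
      AdaptiveKnapsack.expectedUtility p f {estar}) :
    (c estar ≤ b →
      AdaptiveKnapsack.Feasible p c b
        (AdaptiveKnapsack.sad p f c b tie estar (1 / 2) (1 / 5) (2 / 5)
          AdaptiveKnapsack.half_le_one AdaptiveKnapsack.fifths_le_one)) ∧
    ∀ π : AdaptiveKnapsack.Policy E O, AdaptiveKnapsack.Feasible p c b π →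
      (1 / 10 : ℝ≥0∞) * AdaptiveKnapsack.favg p f π ≤
        AdaptiveKnapsack.favg p f
          (AdaptiveKnapsack.sad p f c b tie estar (1 / 2) (1 / 5) (2 / 5)
            AdaptiveKnapsack.half_le_one AdaptiveKnapsack.fifths_le_one) := by
  simpa using mainTheorem1_general (α := 1 / 10) hint hf hc hstar (by norm_num)
    (by rw [← NNReal.coe_lt_coe]; norm_num) _ (by norm_num) (by norm_num) (by norm_num)
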